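/- **Setting.** Let $A\in\mathbb R^{d\times d}$ be stable (all eigenvalues in the open left half-plane), $C\in\mathbb R^{d_{\rm out}\times d}$, $\Gamma_\epsilon\in\mathbb R^{d_{\rm out}\times d_{\rm out}}$ symmetric positive definite, $\Gamma_{\rm pr}=L_{\rm pr}L_{\rm pr}^\top\in\mathbb R^{d\times d}$ (possibly singular) with $L_{\rm pr}\in\mathbb R^{d\times s}$, and $0=t_0<t_1<\dots<t_n$. Consider the Bayesian smoothing problem of inferring $p\sim\mathcal N(0,\Gamma_{\rm pr})$ from $m=(m_1,\dots,m_n)$, $m_k=Ce^{At_k}p+\epsilon_k$ with i.i.d. $\epsilon_k\sim\mathcal N(0,\Gamma_\epsilon)$ independent of $p$. Let $G$ be the matrix with stacked blocks $Ce^{At_1},\dots,Ce^{At_n}$ and $\Gamma_{\rm obs}=\mathrm{diag}(\Gamma_\epsilon,\dots,\Gamma_\epsilon)$. The posterior is $\mathcal N(\mu_{\rm pos}(m),\Gamma_{\rm pos})$ with $$\Gamma_{\rm pos}=\Gamma_{\rm pr}-\Gamma_{\rm pr}G^\top(\Gamma_{\rm obs}+G\Gamma_{\rm pr}G^\top)^{-1}G\Gamma_{\rm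 pr},\qquad \mu_{\rm pos}(m)=\Gamma_{\rm pos}G^\top\Gamma_{\rm obs}^{-1}m.$$ For an approximation $\widehat G$ of $G$, the approximate posterior quantities $\widehat\Gamma_{\rm pos},\widehat\mu_{\rm pos}(m)$ are given by the same formulas with $\widehat G$ in place of $G$. **Prior-driven balanced truncation (PD-BT).** Let $P=\int_0^\infty e^{At}\Gamma_{\rm pr}e^{A^\top t}\,dt=LL^\top$ and $Q=\int_0^\infty e^{A^\top t}C^\top\Gamma_\epsilon^{-1}Ce^{At}\,dt=RR^\top$ with $L,R\in\mathbb R^{d\times d}$, and let $R^\top L=U\Sigma Z^\top$ be a singular value decomposition, $\Sigma=\mathrm{diag}(\sigma_1\ge\dots\ge\sigma_d\ge 0)$ (the Hankel singular values). Let $0\le r\le d$ with $\sigma_i>0$ for all $i\le r$, and put $V=RU\Sigma^{-1/2}$, $W=LZ\Sigma^{-1/2}\in\mathbb R^{d\times d}$ (columns belonging to $\sigma_i=0$ are set to $0$). Let $V_r,W_r$ consist of the first $r$ and $\bar V,\bar W$ of the last $d-r$ columns of $V,W$. Put $A_r=V_r^\top AW_r$, $L_{{\rm pr},r}=V_r^\top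 L_{\rm pr}$, $C_r=CW_r$, and let $\widehat G$ be the matrix with stacked blocks $C_re^{A_rt_1}V_r^\top,\dots,C_re^{A_rt_n}V_r^\top$. Let $S\in\mathbb R^{d\times r}$ be a solution of $A^\top S+SA_r+C^\top\Gamma_\epsilon^{-1}C_r=0$, let $\bar S\in\mathbb R^{(d-r)\times r}$ consist of the last $d-r$ rows of $W^\top S$ (i.e. of $S$ expressed in balanced coordinates), and put $\bar L_{\rm pr}=\bar V^\top L_{\rm pr}$, $\bar A=V_r^\top A\bar W$, $\bar\Sigma=\mathrm{diag}(\sigma_{r+1},\dots,\sigma_d)$. Let $h(t)=\Gamma_\epsilon^{-1/2}Ce^{At}L_{\rm pr}$ and $h_r(t)=\Gamma_\epsilon^{-1/2}C_re^{A_rt}L_{{\rm pr},r}$. **Constants.** Let $\|\cdot\|_F$ be the Frobenius norm, $\|\cdot\|_\infty$ the spectral norm, $\|\cdot\|_2$ the Euclidean norm of vectors, $L_{\rm pr}^\dagger$ the Moore–Penrose inverse, $B=\Gamma_{\rm obs}^{-1/2}GL_{\rm pr}$ and $\widehat B=\Gamma_{\rm obs}^{-1/2}\widehat GL_{\rm pr}$.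 Put $$C_{\rm cov}=\|L_{\rm pr}\|_\infty^2\Big(\|(I+BB^\top)^{-1}B\|_\infty+\|\widehat B\|_\infty\|B\|_\infty(\|B\|_\infty+\|\widehat B\|_\infty)+\|(I+\widehat B\widehat B^\top)^{-1}\widehat B\|_\infty\Big),$$ $$C'=C_{\rm cov}\,\|G^\top\Gamma_{\rm obs}^{-1}m\|_2+\|\widehat\Gamma_{\rm pos}(L_{\rm pr}^\dagger)^\top\|_\infty\,\|\Gamma_{\rm obs}^{-1/2}m\|_2 .$$ **Theorem 4.1 (PD-BT posterior bound).** There are constants $C_1,\dots,C_n\ge0$ with $$\|h(t_k)-h_r(t_k)\|_F^2\le C_k\int_{t_{k-1}}^{t_k}\|h(t)-h_r(t)\|_F^2\,dt,\qquad k=1,\dots,n,$$ and for any such constants, with $\kappa=\max_kC_k$, $$\|\Gamma_{\rm pos}-\widehat\Gamma_{\rm pos}\|_F\le C_{\rm cov}\sqrt{\kappa\cdot\mathrm{trace}\big[(\bar L_{\rm pr}\bar L_{\rm pr}^\top+2\bar S\bar A)\bar\Sigma\big]},$$ $$\|\mu_{\rm pos}(m)-\widehat\mu_{\rm pos}(m)\|_2=\|\mu_{\rm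 pos}(m)-\widehat\mu_{\rm pos}(m)\|_F\le C'\sqrt{\kappa\cdot\mathrm{trace}\big[(\bar L_{\rm pr}\bar L_{\rm pr}^\top+2\bar S\bar A)\bar\Sigma\big]}.$$ -/

import Mathlib

open scoped Matrix Kronecker

noncomputable section

namespace PDBT

/-! ### Norms, square roots and the Moore-Penrose inverse -/

section Norms

/-- Euclidean norm of a coordinate vector. -/
def l2Norm {ι : Type*} [Fintype ι] (v : ι → ℝ) : ℝ := ‖WithLp.toLp 2 v‖

open scoped Matrix.Norms.Frobenius in
/-- Frobenius norm. -/
def frobNorm {ι κ : Type*} [Fintype ι] [Fintype κ] (M : Matrix ι κ ℝ) : ℝ := ‖M‖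

open scoped Matrix.Norms.L2Operator in
/-- Spectral norm, the operator norm with respect to the Euclidean norms. -/
def specNorm {ι κ : Type*} [Fintype ι] [Fintype κ] [DecidableEq κ] (M : Matrix ι κ ℝ) : ℝ := ‖M‖

end Norms

section Functional

variable {ι κ : Type*} [Fintype ι] [DecidableEq ι] [Fintype κ] [DecidableEq κ]

open scoped MatrixOrder in
/-- The principal (positive semidefinite) square root of a positive semidefinite matrix. -/
def psdSqrt (M : Matrix ι ι ℝ) : Matrix ι ι ℝ := CFC.sqrt M

open scoped MatrixOrder in
/-- Defining property of the principal square root. -/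
theorem psdSqrt_spec {M : Matrix ι ι ℝ} (hM : M.PosSemidef) :
    (psdSqrt M).PosSemidef ∧ psdSqrt M * psdSqrt M = M :=
  ⟨Matrix.nonneg_iff_posSemidef.mp (CFC.sqrt_nonneg M), CFC.sqrt_mul_sqrt_self M hM.nonneg⟩

/-- The Moore-Penrose inverse `(MᵀM)⁺ Mᵀ`, where `(MᵀM)⁺` inverts the nonzero eigenvalues of the
symmetric matrix `MᵀM` and keeps the zero ones. -/
def pinv (M : Matrix ι κ ℝ) : Matrix κ ι ℝ := cfc (fun x : ℝ => x⁻¹) (Mᵀ * M) * Mᵀ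

/-- The four Penrose conditions, which determine `pinv M`. -/
theorem pinv_spec (M : Matrix ι κ ℝ) :
    M * pinv M * M = M ∧ pinv M * M * pinv M = pinv M ∧
      (M * pinv M)ᵀ = M * pinv M ∧ (pinv M * M)ᵀ = pinv M * M := by
  have hH : IsSelfAdjoint (Mᵀ * M) := by
    simpa [Matrix.conjTranspose_eq_transpose_of_trivial] using
      (Matrix.isHermitian_conjTranspose_mul_self M).isSelfAdjoint
  have fin : (spectrum ℝ (Mᵀ * M)).Finite := Matrix.finite_real_spectrum
  have hc : ∀ f : ℝ → ℝ, ContinuousOn f (spectrum ℝ (Mᵀ * M)) := fun f => fin.continuousOn f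
  set H := Mᵀ * M with hHd
  set K := cfc (fun x : ℝ => x⁻¹) H with hK
  have hKs : Kᵀ = K := by
    have : IsSelfAdjoint K := cfc_predicate _ _
    simpa [IsSelfAdjoint, Matrix.star_eq_conjTranspose,
      Matrix.conjTranspose_eq_transpose_of_trivial] using this
  have hHs : Hᵀ = H := by simp [hHd]
  have hid : cfc (fun x : ℝ => x) H = H := cfc_id' ℝ H
  have e1 : K * H = cfc (fun x : ℝ => x⁻¹ * x) H := by
    rw [cfc_mul _ _ H (hc _) (hc _), hid]
  have e2 : H * K = K * H := by
    rw [e1, show (fun x : ℝ => x⁻¹ * x) = fun x => x * x⁻¹ from funext fun x => mul_comm _ _,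
      cfc_mul _ _ H (hc _) (hc _), hid]
  have e3 : H * K * H = H := by
    have : H * K * H = cfc (fun x : ℝ => x * x⁻¹ * x) H := by
      rw [cfc_mul _ _ H (hc _) (hc _), cfc_mul _ _ H (hc _) (hc _), hid]
    rw [this]; conv_rhs => rw [← hid]
    congr 1; funext x; exact mul_inv_mul_cancel x
  have e4 : K * H * K = K := by
    have : K * H * K = cfc (fun x : ℝ => x⁻¹ * x * x⁻¹) H := by
      rw [cfc_mul _ _ H (hc _) (hc _), e1]
    rw [this, hK]
    congr 1; funext x; by_cases hx : x = 0 <;> simp [hx]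
  have e5 : M * K * H = M := by
    have h0 : (M * K * H - M)ᵀ * (M * K * H - M) = 0 := by
      have : (M * K * H - M)ᵀ * (M * K * H - M) =
          H * K * (H * K * H) - H * K * H - H * K * H + H := by
        rw [Matrix.transpose_sub, Matrix.transpose_mul (M * K) H, Matrix.transpose_mul M K, hKs, hHs]
        simp only [Matrix.sub_mul, Matrix.mul_sub, hHd, Matrix.mul_assoc]
        abel
      rw [this, e3, e3]; simp
    rw [← Matrix.conjTranspose_eq_transpose_of_trivial,
      Matrix.conjTranspose_mul_self_eq_zero] at h0
    exact sub_eq_zero.mp h0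
  have hp : pinv M = K * Mᵀ := rfl
  refine ⟨?_, ?_, ?_, ?_⟩
  · rw [hp, show M * (K * Mᵀ) * M = M * K * H by simp only [hHd, Matrix.mul_assoc], e5]
  · rw [hp, show K * Mᵀ * M * (K * Mᵀ) = K * H * K * Mᵀ by simp only [hHd, Matrix.mul_assoc], e4]
  · rw [hp]; simp [Matrix.transpose_mul, hKs, Matrix.mul_assoc]
  · rw [hp, show K * Mᵀ * M = K * H by simp only [hHd, Matrix.mul_assoc],
      Matrix.transpose_mul, hKs, hHs, e2]

end Functional

/-! ### The linear Gaussian inverse problem `m = G p + ε` -/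

section Bayes

variable {ω δ ς : Type*} [Fintype ω] [DecidableEq ω] [Fintype δ] [DecidableEq δ]
  [Fintype ς] [DecidableEq ς]

/-- Posterior covariance for the prior covariance `Gpr`, noise covariance `Gobs` and forward
model `G`. -/
def posteriorCov (Gpr : Matrix δ δ ℝ) (Gobs : Matrix ω ω ℝ) (G : Matrix ω δ ℝ) : Matrix δ δ ℝ :=
  Gpr - Gpr * Gᵀ * (Gobs + G * Gpr * Gᵀ)⁻¹ * G * Gpr

/-- Posterior mean for the prior mean `mupr` and the data `m`. -/
def posteriorMean (mupr : δ → ℝ) (Gpr : Matrix δ δ ℝ) (Gobs : Matrix ω ω ℝ) (G : Matrix ω δ ℝ)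
    (m : ω → ℝ) : δ → ℝ :=
  mupr + (posteriorCov Gpr Gobs G * Gᵀ * Gobs⁻¹) *ᵥ (m - G *ᵥ mupr)

/-- Square root `Gobs^{-1/2} G L` of the prior-preconditioned Hessian. -/
def hessSqrt (Gobs : Matrix ω ω ℝ) (G : Matrix ω δ ℝ) (L : Matrix δ ς ℝ) : Matrix ω ς ℝ :=
  (psdSqrt Gobs)⁻¹ * G * L

/-- The local Lipschitz constant `C` of the posterior covariance; `L` is a square root of the prior
covariance, `G` the exact and `Ghat` the approximate forward model. -/
def lipCov (Gobs : Matrix ω ω ℝ) (L : Matrix δ ς ℝ) (G Ghat : Matrix ω δ ℝ) : ℝ :=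
  specNorm L ^ 2 *
    (specNorm ((1 + hessSqrt Gobs G L * (hessSqrt Gobs G L)ᵀ)⁻¹ * hessSqrt Gobs G L)
      + specNorm (hessSqrt Gobs Ghat L) * specNorm (hessSqrt Gobs G L) *
          (specNorm (hessSqrt Gobs G L) + specNorm (hessSqrt Gobs Ghat L))
      + specNorm ((1 + hessSqrt Gobs Ghat L * (hessSqrt Gobs Ghat L)ᵀ)⁻¹ * hessSqrt Gobs Ghat L))

/-- The local Lipschitz constant `C'` of the posterior mean. -/
def lipMean (mupr : δ → ℝ) (Gpr : Matrix δ δ ℝ) (Gobs : Matrix ω ω ℝ) (L : Matrix δ ς ℝ)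
    (G Ghat : Matrix ω δ ℝ) (m : ω → ℝ) : ℝ :=
  lipCov Gobs L G Ghat * l2Norm ((Gᵀ * Gobs⁻¹) *ᵥ (m - G *ᵥ mupr))
    + specNorm (posteriorCov Gpr Gobs Ghat * Gᵀ * (psdSqrt Gobs)⁻¹) * l2Norm (pinv L *ᵥ mupr)
    + specNorm (posteriorCov Gpr Gobs Ghat * (pinv L)ᵀ) *
        l2Norm ((psdSqrt Gobs)⁻¹ *ᵥ (m - Ghat *ᵥ mupr))

end Bayes

/-! ### Linear time-invariant systems and the smoothing problem -/

section LTI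

variable {δ ο ς : Type*} [Fintype δ] [DecidableEq δ] [Fintype ο] [DecidableEq ο] [Fintype ς]

/-- All complex eigenvalues lie in the open left half-plane. -/
def IsStable (A : Matrix δ δ ℝ) : Prop :=
  ∀ z ∈ spectrum ℂ (A.map (algebraMap ℝ ℂ)), z.re < 0

/-- The stacked matrix with blocks `C exp(A t₁), …, C exp(A tₙ)`. -/
def observationMap {n : ℕ} (A : Matrix δ δ ℝ) (C : Matrix ο δ ℝ) (t : Fin n → ℝ) :
    Matrix (Fin n × ο) δ ℝ :=
  Matrix.of fun k j => (C * NormedSpace.exp (t k.1 • A)) k.2 j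

/-- The block diagonal noise covariance of `n` independent measurements. -/
def obsCov (n : ℕ) (Ge : Matrix ο ο ℝ) : Matrix (Fin n × ο) (Fin n × ο) ℝ :=
  (1 : Matrix (Fin n) (Fin n) ℝ) ⊗ₖ Ge

/-- Impulse response `Ge^{-1/2} C exp(A t) B`. -/
def impulseResponse (Ge : Matrix ο ο ℝ) (A : Matrix δ δ ℝ) (B : Matrix δ ς ℝ) (C : Matrix ο δ ℝ)
    (t : ℝ) : Matrix ο ς ℝ :=
  (psdSqrt Ge)⁻¹ * C * NormedSpace.exp (t • A) * B

/-- Reachability Gramian `∫₀^∞ exp(A t) Gpr exp(Aᵀ t) dt` (entrywise integral). -/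
def reachGramian (A Gpr : Matrix δ δ ℝ) : Matrix δ δ ℝ :=
  Matrix.of fun i j => ∫ t in Set.Ioi (0 : ℝ),
    (NormedSpace.exp (t • A) * Gpr * NormedSpace.exp (t • Aᵀ)) i j

/-- Observability Gramian `∫₀^∞ exp(Aᵀ t) Cᵀ Ge⁻¹ C exp(A t) dt` (entrywise integral). -/
def obsGramian (A : Matrix δ δ ℝ) (C : Matrix ο δ ℝ) (Ge : Matrix ο ο ℝ) : Matrix δ δ ℝ :=
  Matrix.of fun i j => ∫ t in Set.Ioi (0 : ℝ),
    (NormedSpace.exp (t • Aᵀ) * Cᵀ * Ge⁻¹ * C * NormedSpace.exp (t • A)) i j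

end LTI

/-! ### Square-root balancing -/

section Balancing

/-- Square root factors `P = L Lᵀ` and `Q = R Rᵀ` of the Gramians and a singular value decomposition
`Rᵀ L = U diag(σ) Zᵀ` with decreasingly ordered singular values (the Hankel singular values). -/
structure IsBalancing {d : ℕ} (P Q L R U Z : Matrix (Fin d) (Fin d) ℝ) (σ : Fin d → ℝ) : Prop where
  reach_factor : P = L * Lᵀ
  obs_factor : Q = R * Rᵀ
  left_orthogonal : U ∈ Matrix.orthogonalGroup (Fin d) ℝ
  right_orthogonal : Z ∈ Matrix.orthogonalGroup (Fin d) ℝ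
  svd : Rᵀ * L = U * Matrix.diagonal σ * Zᵀ
  nonneg : ∀ i, 0 ≤ σ i
  antitone : Antitone σ

/-- The balancing basis `F X Σ^{-1/2}`: `V` for `F = R`, `X = U`, and `W` for `F = L`, `X = Z`.
Columns that belong to a vanishing singular value are set to zero. -/
def balBasis {d : ℕ} (F X : Matrix (Fin d) (Fin d) ℝ) (σ : Fin d → ℝ) :
    Matrix (Fin d) (Fin d) ℝ :=
  F * X * Matrix.diagonal fun i => (Real.sqrt (σ i))⁻¹

/-- The first `r` columns. -/
def leadingCols {r q : ℕ} {δ : Type*} (M : Matrix δ (Fin (r + q)) ℝ) : Matrix δ (Fin r) ℝ :=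
  M.submatrix id (Fin.castAdd q)

/-- The last `q` columns. -/
def trailingCols {r q : ℕ} {δ : Type*} (M : Matrix δ (Fin (r + q)) ℝ) : Matrix δ (Fin q) ℝ :=
  M.submatrix id (Fin.natAdd r)

/-- The last `q` rows. -/
def trailingRows {r q : ℕ} {δ : Type*} (M : Matrix (Fin (r + q)) δ ℝ) : Matrix (Fin q) δ ℝ :=
  M.submatrix (Fin.natAdd r) id

end Balancing

/-! ### The sampling constant -/

/-- The time preceding `t k`, with the convention that `0` precedes the first time. -/
def prevTime {n : ℕ} (t : Fin n → ℝ) (k : Fin n) : ℝ :=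
  if h : (k : ℕ) = 0 then 0 else t ⟨(k : ℕ) - 1, by omega⟩

/-- Nonnegative constants `c k` that bound `‖e(t_k)‖_F²` by `c k ∫_{t_{k-1}}^{t_k} ‖e(t)‖_F² dt`. -/
def IsSamplingBound {n : ℕ} {ο ς : Type*} [Fintype ο] [Fintype ς] (e : ℝ → Matrix ο ς ℝ)
    (t : Fin n → ℝ) (c : Fin n → ℝ) : Prop :=
  ∀ k, 0 ≤ c k ∧ frobNorm (e (t k)) ^ 2 ≤ c k * ∫ τ in (prevTime t k)..(t k), frobNorm (e τ) ^ 2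

end PDBT

end

/-!
The posterior only sees the forward model through the whitened matrix `B = Gobs^{-1/2} G Lpr`: the
covariance is `Lpr (1 - Bᵀ (1 + B Bᵀ)⁻¹ B) Lprᵀ` (`posteriorCov_eq`), and `B ↦ Bᵀ (1 + B Bᵀ)⁻¹ B`
is locally Lipschitz in the Frobenius norm because the resolvents are contractions
(`frobNorm_resolvent_sub_le`). The covariance bound and, after inserting `Lprᵀ (Lpr⁺)ᵀ Lprᵀ =
Lprᵀ`, the bound for the mean follow with the factor `‖B - B̂‖_F`. The blocks of `B - B̂` are the
values `e (t_k)` of the impulse response error, so the sampling constants give `‖B - B̂‖_F² ≤ κ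
∫₀^T ‖e‖_F²` with `T` the last sampling time.

The energy `∫₀^T ‖e‖_F²` is controlled by the quadratic form `errorForm` of the matrix `[[Q, -S],
[-Sᵀ, Σ₁]]`, which solves the observability Lyapunov equation of the error system: along the flow
the form decreases at the rate `‖e‖_F²`, so the energy is at most its initial value as long as the
form is nonnegative (`integral_output_error_le`). Equal singular values on both sides of the cut
are allowed, so the reduced matrix need not be stable. But `Σ₁ > 0` solves a Lyapunov equation for
the reduced system, hence the reduced flow is bounded (`bounded_flow_of_lyapunov`), while the full
flow decays; the mixed term therefore vanishes in the limit and the form is nonnegative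
(`errorForm_nonneg`).

It remains to identify the initial value with the stated trace (`IsBalancing.errorForm_eq`). In
balanced coordinates this is linear algebra with the blocks of the Lyapunov and Sylvester
equations (`balanced_trace_identity`). The Gramians may be singular, and then `W Vᵀ` is only an
oblique projection. It changes `Lpr` and `A W` by vectors in the kernel of `Q`
(`IsBalancing.proj_mul_factor`, `annihilates_of_lyapunov`), and since `errorForm` is nonnegative,
`Sᵀ` vanishes on that kernel (`sylvester_transpose_mul_eq_zero`), so the singular case reduces to
the same identity.
-/

noncomputable section

namespace PDBT

/-! ### Frobenius and spectral norms -/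

section NormLemmas

variable {ι κ μ : Type*} [Fintype ι] [Fintype κ] [Fintype μ]

theorem l2Norm_sq (v : ι → ℝ) : l2Norm v ^ 2 = ∑ i, v i ^ 2 := by
  simp [l2Norm, EuclideanSpace.norm_sq_eq]

theorem l2Norm_nonneg (v : ι → ℝ) : 0 ≤ l2Norm v := norm_nonneg _

theorem l2Norm_zero : l2Norm (0 : ι → ℝ) = 0 := by simp [l2Norm]

theorem l2Norm_add_le (v w : ι → ℝ) : l2Norm (v + w) ≤ l2Norm v + l2Norm w := by
  simpa [l2Norm] using norm_add_le (WithLp.toLp 2 v) (WithLp.toLp 2 w)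

theorem dotProduct_le_l2Norm_mul (v w : ι → ℝ) : v ⬝ᵥ w ≤ l2Norm v * l2Norm w := by
  have := real_inner_le_norm (WithLp.toLp 2 w) (WithLp.toLp 2 v)
  rw [EuclideanSpace.inner_toLp_toLp] at this
  simpa [l2Norm, mul_comm] using this

theorem frobNorm_sq (M : Matrix ι κ ℝ) : frobNorm M ^ 2 = ∑ i, ∑ j, M i j ^ 2 := by
  unfold frobNorm
  rw [Matrix.frobenius_norm_def, ← Real.sqrt_eq_rpow, Real.sq_sqrt (by positivity)]
  simp

theorem frobNorm_nonneg (M : Matrix ι κ ℝ) : 0 ≤ frobNorm M := by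
  open scoped Matrix.Norms.Frobenius in exact norm_nonneg M

theorem frobNorm_eq_zero {M : Matrix ι κ ℝ} : frobNorm M = 0 ↔ M = 0 := by
  open scoped Matrix.Norms.Frobenius in exact norm_eq_zero

theorem frobNorm_add_le (M N : Matrix ι κ ℝ) : frobNorm (M + N) ≤ frobNorm M + frobNorm N := by
  open scoped Matrix.Norms.Frobenius in exact norm_add_le M N

theorem frobNorm_transpose (M : Matrix ι κ ℝ) : frobNorm Mᵀ = frobNorm M := by
  open scoped Matrix.Norms.Frobenius in exact Matrix.frobenius_norm_transpose M

theorem frobNorm_neg (M : Matrix ι κ ℝ) : frobNorm (-M) = frobNorm M := by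
  open scoped Matrix.Norms.Frobenius in exact norm_neg M

theorem frobNorm_replicateCol (v : ι → ℝ) : frobNorm (Matrix.replicateCol Unit v) = l2Norm v := by
  open scoped Matrix.Norms.Frobenius in exact Matrix.frobenius_norm_replicateCol v

theorem specNorm_nonneg [DecidableEq κ] (M : Matrix ι κ ℝ) : 0 ≤ specNorm M := by
  open scoped Matrix.Norms.L2Operator in exact norm_nonneg M

theorem specNorm_transpose [DecidableEq ι] [DecidableEq κ] (M : Matrix ι κ ℝ) :
    specNorm Mᵀ = specNorm M := by
  rw [← Matrix.conjTranspose_eq_transpose_of_trivial]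
  exact Matrix.l2_opNorm_conjTranspose M

theorem l2Norm_mulVec_le [DecidableEq κ] (M : Matrix ι κ ℝ) (v : κ → ℝ) :
    l2Norm (M *ᵥ v) ≤ specNorm M * l2Norm v :=
  Matrix.l2_opNorm_mulVec M (WithLp.toLp 2 v)

theorem frobNorm_mul_le_specNorm_mul [DecidableEq κ] (M : Matrix ι κ ℝ) (N : Matrix κ μ ℝ) :
    frobNorm (M * N) ≤ specNorm M * frobNorm N := by
  refine le_of_sq_le_sq ?_ (mul_nonneg (specNorm_nonneg M) (frobNorm_nonneg N))
  rw [mul_pow, frobNorm_sq, frobNorm_sq, Finset.sum_comm, Finset.sum_comm (γ := κ),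
    Finset.mul_sum]
  refine Finset.sum_le_sum fun j _ => ?_
  have h := l2Norm_mulVec_le M (fun k => N k j)
  have h2 := pow_le_pow_left₀ (l2Norm_nonneg _) h 2
  rw [mul_pow, l2Norm_sq, l2Norm_sq] at h2
  exact h2

theorem frobNorm_mul_le_mul_specNorm [DecidableEq κ] [DecidableEq μ] (M : Matrix ι κ ℝ)
    (N : Matrix κ μ ℝ) :
    frobNorm (M * N) ≤ frobNorm M * specNorm N := by
  rw [← frobNorm_transpose, Matrix.transpose_mul, ← frobNorm_transpose M, ← specNorm_transpose N,
    mul_comm]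
  exact frobNorm_mul_le_specNorm_mul _ _

theorem l2Norm_mulVec_le_frobNorm (M : Matrix ι κ ℝ) (v : κ → ℝ) :
    l2Norm (M *ᵥ v) ≤ frobNorm M * l2Norm v := by
  rw [← frobNorm_replicateCol, ← frobNorm_replicateCol, Matrix.replicateCol_mulVec]
  open scoped Matrix.Norms.Frobenius in exact Matrix.frobenius_norm_mul _ _

theorem specNorm_le_one_of [DecidableEq κ] {M : Matrix ι κ ℝ}
    (h : ∀ v, l2Norm (M *ᵥ v) ≤ l2Norm v) :
    specNorm M ≤ 1 := by
  unfold specNorm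
  rw [Matrix.l2_opNorm_def]
  refine ContinuousLinearMap.opNorm_le_bound _ zero_le_one fun x => ?_
  rw [one_mul]
  exact h x.ofLp

end NormLemmas

/-! ### Lipschitz continuity of the posterior -/

section Resolvent

variable {ω ς : Type*} [Fintype ω] [DecidableEq ω] [Fintype ς]

theorem posDef_one_add_mul_transpose (B : Matrix ω ς ℝ) : (1 + B * Bᵀ).PosDef := by
  have := Matrix.PosDef.one.add_posSemidef (Matrix.posSemidef_self_mul_conjTranspose B)
  rwa [Matrix.conjTranspose_eq_transpose_of_trivial] at this

theorem isUnit_one_add_mul_transpose (B : Matrix ω ς ℝ) : IsUnit (1 + B * Bᵀ).det :=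
  (Matrix.isUnit_iff_isUnit_det _).1 (posDef_one_add_mul_transpose B).isUnit

theorem specNorm_inv_one_add_le_one (B : Matrix ω ς ℝ) : specNorm (1 + B * Bᵀ)⁻¹ ≤ 1 := by
  refine specNorm_le_one_of fun v => ?_
  have hv : (1 + B * Bᵀ) *ᵥ ((1 + B * Bᵀ)⁻¹ *ᵥ v) = v := by
    rw [Matrix.mulVec_mulVec, Matrix.mul_nonsing_inv _ (isUnit_one_add_mul_transpose B),
      Matrix.one_mulVec]
  generalize (1 + B * Bᵀ)⁻¹ *ᵥ v = y at hv ⊢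
  rw [Matrix.add_mulVec, Matrix.one_mulVec, ← Matrix.mulVec_mulVec] at hv
  have h1 : y ⬝ᵥ v = l2Norm y ^ 2 + l2Norm (Bᵀ *ᵥ y) ^ 2 := by
    rw [← hv, dotProduct_add, Matrix.dotProduct_mulVec, ← Matrix.mulVec_transpose, l2Norm_sq,
      l2Norm_sq]
    simp only [dotProduct, sq]
  have h2 := dotProduct_le_l2Norm_mul y v
  by_contra! hlt
  have := l2Norm_nonneg v
  nlinarith [sq_nonneg (l2Norm (Bᵀ *ᵥ y))]

/-- Local Lipschitz continuity of `B ↦ Bᵀ (1 + B Bᵀ)⁻¹ B`; the resolvents have spectral norm at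
most one, and `M - N = M (N⁻¹ - M⁻¹) N` for the two resolvents `M` and `N`. -/
theorem frobNorm_resolvent_sub_le [DecidableEq ς] (B D : Matrix ω ς ℝ) :
    frobNorm (Bᵀ * (1 + B * Bᵀ)⁻¹ * B - Dᵀ * (1 + D * Dᵀ)⁻¹ * D) ≤
      (specNorm ((1 + B * Bᵀ)⁻¹ * B) + specNorm D * specNorm B * (specNorm B + specNorm D) +
        specNorm ((1 + D * Dᵀ)⁻¹ * D)) * frobNorm (B - D) := by
  set M := (1 + B * Bᵀ)⁻¹ with hM
  set N := (1 + D * Dᵀ)⁻¹ with hN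
  have hNt : Nᵀ = N := by
    rw [hN, Matrix.transpose_nonsing_inv]; simp
  have hM1 : M * (1 + B * Bᵀ) = 1 := Matrix.nonsing_inv_mul _ (isUnit_one_add_mul_transpose B)
  have hN1 : (1 + D * Dᵀ) * N = 1 := Matrix.mul_nonsing_inv _ (isUnit_one_add_mul_transpose D)
  have hMN : M - N = M * (-((B - D) * Dᵀ + B * (B - D)ᵀ)) * N := by
    have e : -((B - D) * Dᵀ + B * (B - D)ᵀ) = (1 + D * Dᵀ) - (1 + B * Bᵀ) := by
      rw [Matrix.transpose_sub, Matrix.sub_mul, Matrix.mul_sub]; abel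
    rw [e, Matrix.mul_sub, Matrix.sub_mul, hM1, Matrix.mul_assoc, hN1, Matrix.mul_one,
      Matrix.one_mul]
  have hsplit : Bᵀ * M * B - Dᵀ * N * D =
      (B - D)ᵀ * (M * B) + Dᵀ * ((M - N) * B) + (N * D)ᵀ * (B - D) := by
    rw [Matrix.transpose_mul, hNt, Matrix.transpose_sub, Matrix.sub_mul, Matrix.sub_mul,
      Matrix.mul_sub, Matrix.mul_sub]
    simp only [Matrix.mul_assoc]
    abel
  have hm := specNorm_inv_one_add_le_one B
  have hn := specNorm_inv_one_add_le_one D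
  rw [← hM] at hm
  rw [← hN] at hn
  have b0 := specNorm_nonneg B
  have d0 := specNorm_nonneg D
  have n0 := specNorm_nonneg N
  have f0 := frobNorm_nonneg (B - D)
  have hdiff : frobNorm (M - N) ≤ (specNorm B + specNorm D) * frobNorm (B - D) := by
    rw [hMN]
    have k1 : frobNorm (-((B - D) * Dᵀ + B * (B - D)ᵀ)) ≤
        (specNorm B + specNorm D) * frobNorm (B - D) := by
      rw [frobNorm_neg]
      refine (frobNorm_add_le _ _).trans ?_
      have a1 := frobNorm_mul_le_mul_specNorm (B - D) Dᵀ
      have a2 := frobNorm_mul_le_specNorm_mul B (B - D)ᵀ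
      rw [specNorm_transpose] at a1
      rw [frobNorm_transpose] at a2
      linarith
    have k2 := frobNorm_mul_le_specNorm_mul M (-((B - D) * Dᵀ + B * (B - D)ᵀ))
    have k3 := frobNorm_mul_le_mul_specNorm (M * (-((B - D) * Dᵀ + B * (B - D)ᵀ))) N
    have f1 := frobNorm_nonneg (M * (-((B - D) * Dᵀ + B * (B - D)ᵀ)))
    have f2 := frobNorm_nonneg (-((B - D) * Dᵀ + B * (B - D)ᵀ))
    calc _ ≤ _ := k3
      _ ≤ frobNorm (M * (-((B - D) * Dᵀ + B * (B - D)ᵀ))) := mul_le_of_le_one_right f1 hn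
      _ ≤ _ := k2
      _ ≤ _ := mul_le_of_le_one_left f2 hm
      _ ≤ _ := k1
  have t1 : frobNorm ((B - D)ᵀ * (M * B)) ≤ frobNorm (B - D) * specNorm (M * B) := by
    have := frobNorm_mul_le_mul_specNorm (B - D)ᵀ (M * B)
    rwa [frobNorm_transpose] at this
  have t2 : frobNorm (Dᵀ * ((M - N) * B)) ≤
      specNorm D * ((specNorm B + specNorm D) * frobNorm (B - D) * specNorm B) := by
    have a1 := frobNorm_mul_le_specNorm_mul Dᵀ ((M - N) * B)
    rw [specNorm_transpose] at a1
    refine a1.trans (mul_le_mul_of_nonneg_left ?_ d0)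
    exact (frobNorm_mul_le_mul_specNorm _ _).trans (mul_le_mul_of_nonneg_right hdiff b0)
  have t3 : frobNorm ((N * D)ᵀ * (B - D)) ≤ specNorm (N * D) * frobNorm (B - D) := by
    have := frobNorm_mul_le_specNorm_mul (N * D)ᵀ (B - D)
    rwa [specNorm_transpose] at this
  rw [hsplit]
  have s1 := frobNorm_add_le ((B - D)ᵀ * (M * B) + Dᵀ * ((M - N) * B)) ((N * D)ᵀ * (B - D))
  have s2 := frobNorm_add_le ((B - D)ᵀ * (M * B)) (Dᵀ * ((M - N) * B))
  linarith

end Resolvent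

section Posterior

variable {ω δ ς : Type*} [Fintype ω] [DecidableEq ω] [Fintype δ] [DecidableEq δ]
  [Fintype ς] [DecidableEq ς]

theorem isUnit_det_psdSqrt {M : Matrix ω ω ℝ} (hM : M.PosDef) : IsUnit (psdSqrt M).det := by
  have h := (psdSqrt_spec hM.posSemidef).2
  have hu := (Matrix.isUnit_iff_isUnit_det _).1 hM.isUnit
  rw [← h, Matrix.det_mul] at hu
  exact isUnit_of_mul_isUnit_left hu

theorem psdSqrt_transpose {M : Matrix ω ω ℝ} (hM : M.PosSemidef) : (psdSqrt M)ᵀ = psdSqrt M := by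
  have h := (psdSqrt_spec hM).1.isHermitian
  rwa [Matrix.IsHermitian, Matrix.conjTranspose_eq_transpose_of_trivial] at h

theorem inv_psdSqrt_transpose {M : Matrix ω ω ℝ} (hM : M.PosSemidef) :
    ((psdSqrt M)⁻¹)ᵀ = (psdSqrt M)⁻¹ := by
  rw [Matrix.transpose_nonsing_inv, psdSqrt_transpose hM]

theorem inv_psdSqrt_mul_self {M : Matrix ω ω ℝ} (hM : M.PosSemidef) :
    (psdSqrt M)⁻¹ * (psdSqrt M)⁻¹ = M⁻¹ := by
  rw [← Matrix.mul_inv_rev, (psdSqrt_spec hM).2]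

omit [DecidableEq δ] in
/-- The posterior covariance in terms of the prior-preconditioned Hessian. -/
theorem posteriorCov_eq {Gobs : Matrix ω ω ℝ} (hG : Gobs.PosDef) (L : Matrix δ ς ℝ)
    (G : Matrix ω δ ℝ) :
    posteriorCov (L * Lᵀ) Gobs G =
      L * (1 - (hessSqrt Gobs G L)ᵀ * (1 + hessSqrt Gobs G L * (hessSqrt Gobs G L)ᵀ)⁻¹ *
        hessSqrt Gobs G L) * Lᵀ := by
  set K := psdSqrt Gobs with hK
  have hKu : IsUnit K.det := isUnit_det_psdSqrt hG
  have hKK : K * K = Gobs := (psdSqrt_spec hG.posSemidef).2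
  have hKt : (K⁻¹)ᵀ = K⁻¹ := inv_psdSqrt_transpose hG.posSemidef
  have e : Gobs + G * (L * Lᵀ) * Gᵀ =
      K * (1 + hessSqrt Gobs G L * (hessSqrt Gobs G L)ᵀ) * K := by
    have h1 : K * hessSqrt Gobs G L = G * L := by
      rw [hessSqrt, ← hK, Matrix.mul_assoc K⁻¹, Matrix.mul_nonsing_inv_cancel_left _ _ hKu]
    have h2 : (hessSqrt Gobs G L)ᵀ * K = Lᵀ * Gᵀ := by
      have := congrArg Matrix.transpose h1
      rwa [Matrix.transpose_mul, Matrix.transpose_mul, hK, psdSqrt_transpose hG.posSemidef,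
        ← hK] at this
    rw [Matrix.mul_add, Matrix.add_mul, Matrix.mul_one, hKK, ← Matrix.mul_assoc K, h1,
      Matrix.mul_assoc (G * L), h2]
    simp only [Matrix.mul_assoc]
  rw [posteriorCov, e, Matrix.mul_inv_rev, Matrix.mul_inv_rev, Matrix.mul_sub, Matrix.sub_mul]
  have h3 : (hessSqrt Gobs G L)ᵀ = Lᵀ * Gᵀ * K⁻¹ := by
    rw [hessSqrt, ← hK, Matrix.transpose_mul, Matrix.transpose_mul, hKt, Matrix.mul_assoc]
  generalize (1 + hessSqrt Gobs G L * (hessSqrt Gobs G L)ᵀ)⁻¹ = X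
  rw [h3, hessSqrt, ← hK, Matrix.mul_one]
  simp only [Matrix.mul_assoc]

theorem frobNorm_posteriorCov_sub_le {Gobs : Matrix ω ω ℝ} (hG : Gobs.PosDef) (L : Matrix δ ς ℝ)
    (G Ghat : Matrix ω δ ℝ) :
    frobNorm (posteriorCov (L * Lᵀ) Gobs G - posteriorCov (L * Lᵀ) Gobs Ghat) ≤
      lipCov Gobs L G Ghat * frobNorm (hessSqrt Gobs G L - hessSqrt Gobs Ghat L) := by
  rw [posteriorCov_eq hG, posteriorCov_eq hG, ← Matrix.sub_mul, ← Matrix.mul_sub,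
    sub_sub_sub_cancel_left, lipCov]
  set B := hessSqrt Gobs G L
  set D := hessSqrt Gobs Ghat L
  have h := frobNorm_resolvent_sub_le B D
  set X := Bᵀ * (1 + B * Bᵀ)⁻¹ * B
  set Y := Dᵀ * (1 + D * Dᵀ)⁻¹ * D
  have l0 := specNorm_nonneg L
  have h1 := frobNorm_mul_le_mul_specNorm (L * (Y - X)) Lᵀ
  have h2 := frobNorm_mul_le_specNorm_mul L (Y - X)
  rw [specNorm_transpose] at h1
  have h3 : frobNorm (Y - X) = frobNorm (X - Y) := by rw [← neg_sub, frobNorm_neg]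
  rw [h3] at h2
  calc _ ≤ _ := h1
    _ ≤ specNorm L * frobNorm (X - Y) * specNorm L := mul_le_mul_of_nonneg_right h2 l0
    _ = specNorm L ^ 2 * frobNorm (X - Y) := by ring
    _ ≤ specNorm L ^ 2 * _ := mul_le_mul_of_nonneg_left h (by positivity)
    _ = _ := by ring

/-- The posterior covariance factors through `Lᵀ`, on which the pseudoinverse of `L`
acts as an inverse. -/
theorem posteriorCov_mul_pinv {Gobs : Matrix ω ω ℝ} (hG : Gobs.PosDef) (L : Matrix δ ς ℝ)
    (G : Matrix ω δ ℝ) :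
    posteriorCov (L * Lᵀ) Gobs G * (pinv L)ᵀ * Lᵀ = posteriorCov (L * Lᵀ) Gobs G := by
  have h : Lᵀ * (pinv L)ᵀ * Lᵀ = Lᵀ := by
    rw [← Matrix.transpose_mul, ← Matrix.transpose_mul, ← Matrix.mul_assoc, (pinv_spec L).1]
  rw [posteriorCov_eq hG]
  generalize (1 - (hessSqrt Gobs G L)ᵀ * (1 + hessSqrt Gobs G L * (hessSqrt Gobs G L)ᵀ)⁻¹ *
        hessSqrt Gobs G L) = X
  calc L * X * Lᵀ * (pinv L)ᵀ * Lᵀ = L * X * (Lᵀ * (pinv L)ᵀ * Lᵀ) := by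
        simp only [Matrix.mul_assoc]
    _ = _ := by rw [h]

theorem l2Norm_posteriorMean_sub_le {Gobs : Matrix ω ω ℝ} (hG : Gobs.PosDef) (L : Matrix δ ς ℝ)
    (G Ghat : Matrix ω δ ℝ) (m : ω → ℝ) :
    l2Norm (posteriorMean 0 (L * Lᵀ) Gobs G m - posteriorMean 0 (L * Lᵀ) Gobs Ghat m) ≤
      lipMean 0 (L * Lᵀ) Gobs L G Ghat m *
        frobNorm (hessSqrt Gobs G L - hessSqrt Gobs Ghat L) := by
  have hcov := frobNorm_posteriorCov_sub_le hG L G Ghat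
  have hpinv := posteriorCov_mul_pinv hG L Ghat
  simp only [posteriorMean, lipMean, Matrix.mulVec_zero, sub_zero, zero_add, l2Norm_zero,
    mul_zero, add_zero]
  set P := posteriorCov (L * Lᵀ) Gobs G
  set Phat := posteriorCov (L * Lᵀ) Gobs Ghat
  set K := psdSqrt Gobs with hK
  have hKt : (K⁻¹)ᵀ = K⁻¹ := inv_psdSqrt_transpose hG.posSemidef
  have hKK : K⁻¹ * K⁻¹ = Gobs⁻¹ := inv_psdSqrt_mul_self hG.posSemidef
  have ht : (hessSqrt Gobs G L - hessSqrt Gobs Ghat L)ᵀ * K⁻¹ = Lᵀ * (Gᵀ - Ghatᵀ) * Gobs⁻¹ := by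
    simp only [hessSqrt, ← hK, Matrix.transpose_sub, Matrix.transpose_mul, hKt, ← hKK,
      Matrix.mul_sub, Matrix.sub_mul, Matrix.mul_assoc]
  have e : (P * Gᵀ * Gobs⁻¹) *ᵥ m - (Phat * Ghatᵀ * Gobs⁻¹) *ᵥ m =
      (P - Phat) *ᵥ ((Gᵀ * Gobs⁻¹) *ᵥ m) + (Phat * (pinv L)ᵀ) *ᵥ
        ((hessSqrt Gobs G L - hessSqrt Gobs Ghat L)ᵀ *ᵥ (K⁻¹ *ᵥ m)) := by
    rw [Matrix.mulVec_mulVec m (hessSqrt Gobs G L - hessSqrt Gobs Ghat L)ᵀ, ht,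
      Matrix.mulVec_mulVec, Matrix.mulVec_mulVec, ← Matrix.sub_mulVec, ← Matrix.add_mulVec]
    congr 1
    rw [← Matrix.mul_assoc (Phat * (pinv L)ᵀ), ← Matrix.mul_assoc (Phat * (pinv L)ᵀ), hpinv]
    simp only [Matrix.mul_sub, Matrix.sub_mul, Matrix.mul_assoc]
    abel
  rw [e]
  set D := hessSqrt Gobs G L - hessSqrt Gobs Ghat L
  have a1 := (l2Norm_mulVec_le_frobNorm (P - Phat) ((Gᵀ * Gobs⁻¹) *ᵥ m)).trans
    (mul_le_mul_of_nonneg_right hcov (l2Norm_nonneg _))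
  have a2 := l2Norm_mulVec_le (Phat * (pinv L)ᵀ) (Dᵀ *ᵥ (K⁻¹ *ᵥ m))
  have a3 := l2Norm_mulVec_le_frobNorm Dᵀ (K⁻¹ *ᵥ m)
  rw [frobNorm_transpose] at a3
  have a4 := mul_le_mul_of_nonneg_left a3 (specNorm_nonneg (Phat * (pinv L)ᵀ))
  have a5 := l2Norm_add_le ((P - Phat) *ᵥ ((Gᵀ * Gobs⁻¹) *ᵥ m))
    ((Phat * (pinv L)ᵀ) *ᵥ (Dᵀ *ᵥ (K⁻¹ *ᵥ m)))
  calc _ ≤ _ := a5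
    _ ≤ _ := add_le_add a1 (a2.trans a4)
    _ = _ := by ring

end Posterior

/-! ### Exponential decay of stable flows -/

open Filter Asymptotics Topology MeasureTheory

section Exponential

variable {δ : Type*} [Fintype δ] [DecidableEq δ]

open scoped Matrix.Norms.Operator in
theorem exp_map_ofReal (A : Matrix δ δ ℝ) (t : ℝ) :
    (NormedSpace.exp (t • A)).map (algebraMap ℝ ℂ) =
      NormedSpace.exp ((t : ℂ) • A.map (algebraMap ℝ ℂ)) := by
  have hc : Continuous ⇑((algebraMap ℝ ℂ).mapMatrix : Matrix δ δ ℝ →+* Matrix δ δ ℂ) := by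
    refine continuous_matrix fun i j => ?_
    exact Complex.continuous_ofReal.comp (continuous_id.matrix_elem i j)
  have h := NormedSpace.map_exp ((algebraMap ℝ ℂ).mapMatrix : Matrix δ δ ℝ →+* Matrix δ δ ℂ) hc
    (t • A)
  have e : (algebraMap ℝ ℂ).mapMatrix (t • A) = (t : ℂ) • A.map (algebraMap ℝ ℂ) := by
    ext i j; simp
  rw [e] at h
  exact h

open scoped Matrix.Norms.Operator in
/-- On a vector annihilated by a power of `N`, the exponential of `z • N` is a polynomial in `z`. -/
theorem exp_smul_mulVec_of_pow_mulVec_eq_zero (N : Matrix δ δ ℂ) (v : δ → ℂ) (k : ℕ)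
    (h : (N ^ k) *ᵥ v = 0) (z : ℂ) :
    NormedSpace.exp (z • N) *ᵥ v =
      ∑ j ∈ Finset.range k, ((j.factorial : ℂ)⁻¹ * z ^ j) • ((N ^ j) *ᵥ v) := by
  have hs := NormedSpace.exp_series_hasSum_exp' (𝕂 := ℂ) (z • N)
  let φ : Matrix δ δ ℂ →+ (δ → ℂ) :=
    { toFun := fun M => M *ᵥ v, map_zero' := by simp, map_add' := fun a b => by
        simp [Matrix.add_mulVec] }
  have hφ : Continuous φ := by
    change Continuous fun M : Matrix δ δ ℂ => M *ᵥ v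
    fun_prop
  have h2 := hs.map φ hφ
  have h3 : ∀ j ∉ Finset.range k,
      (φ ∘ fun n : ℕ => ((n.factorial : ℂ)⁻¹) • (z • N) ^ n) j = 0 := by
    intro j hj
    have hj' : k ≤ j := by simpa using hj
    change (((j.factorial : ℂ)⁻¹) • (z • N) ^ j) *ᵥ v = 0
    rw [smul_pow, ← Nat.sub_add_cancel hj', pow_add N, Matrix.smul_mulVec, Matrix.smul_mulVec,
      ← Matrix.mulVec_mulVec, h]
    simp
  have h4 := h2.unique (hasSum_sum_of_ne_finset_zero h3)
  change NormedSpace.exp (z • N) *ᵥ v = _ at h4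
  rw [h4]
  refine Finset.sum_congr rfl fun j _ => ?_
  change (((j.factorial : ℂ)⁻¹) • (z • N) ^ j) *ᵥ v = _
  rw [smul_pow, smul_smul, Matrix.smul_mulVec]

theorem exp_mulVec_eq_exp_shift (A : Matrix δ δ ℂ) (μ z : ℂ) (v : δ → ℂ) :
    NormedSpace.exp (z • A) *ᵥ v =
      Complex.exp (z * μ) • (NormedSpace.exp (z • (A - μ • 1)) *ᵥ v) := by
  have h : z • A = Matrix.diagonal (fun _ => z * μ) + z • (A - μ • 1) := by
    rw [smul_sub, smul_smul, ← Matrix.smul_one_eq_diagonal]; abel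
  have hc : Commute (Matrix.diagonal (fun _ : δ => z * μ)) (z • (A - μ • 1)) := by
    rw [← Matrix.smul_one_eq_diagonal]
    exact (Commute.one_left _).smul_left _
  rw [h, Matrix.exp_add_of_commute _ _ hc, Matrix.exp_diagonal, ← Matrix.mulVec_mulVec]
  have : NormedSpace.exp (fun _ : δ => z * μ) = fun _ => Complex.exp (z * μ) := by
    funext i
    rw [Pi.coe_exp, Complex.exp_eq_exp_ℂ]
  rw [this, ← Matrix.smul_one_eq_diagonal, Matrix.smul_mulVec, Matrix.one_mulVec]

/-- A polynomial times a decaying exponential still decays exponentially. -/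
theorem isBigO_pow_mul_exp {μ : ℂ} (hμ : μ.re < 0) (c : ℂ) (j : ℕ) :
    (fun t : ℝ => Complex.exp (t * μ) * (c * (t : ℂ) ^ j)) =O[atTop]
      fun t : ℝ => Real.exp (-(-μ.re / 2) * t) := by
  have h1 : (fun t : ℝ => t ^ j) =o[atTop] fun t : ℝ => Real.exp ((-μ.re / 2) * t) :=
    isLittleO_pow_exp_pos_mul_atTop j (by linarith)
  have h2 : (fun t : ℝ => Complex.exp (t * μ)) =O[atTop] fun t : ℝ => Real.exp (μ.re * t) := by
    refine IsBigO.of_norm_left ?_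
    have : (fun t : ℝ => ‖Complex.exp (t * μ)‖) = fun t : ℝ => Real.exp (μ.re * t) := by
      funext t
      rw [Complex.norm_exp]; simp [mul_comm]
    rw [this]
  have h3 : (fun t : ℝ => c * (t : ℂ) ^ j) =O[atTop] fun t : ℝ => t ^ j := by
    refine IsBigO.const_mul_left ?_ c
    refine IsBigO.of_norm_left ?_
    have : (fun t : ℝ => ‖(t : ℂ) ^ j‖) = fun t : ℝ => ‖t ^ j‖ := by
      funext t; simp
    rw [this]
    exact (isBigO_refl _ _).norm_left
  refine (h2.mul (h3.trans h1.isBigO)).trans (IsBigO.of_norm_eventuallyLE ?_)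
  filter_upwards with t
  rw [← Real.exp_add]
  simp only [Real.norm_eq_abs, Real.abs_exp]
  exact le_of_eq (by ring_nf)

theorem isBigO_exp_neg_of_le {a b : ℝ} (h : a ≤ b) :
    (fun t : ℝ => Real.exp (-b * t)) =O[atTop] fun t : ℝ => Real.exp (-a * t) := by
  refine IsBigO.of_norm_eventuallyLE ?_
  filter_upwards [eventually_ge_atTop 0] with t ht
  simp only [Real.norm_eq_abs, Real.abs_exp]
  refine Real.exp_le_exp.mpr ?_
  nlinarith

/-- The initial states from which the flow of `A` decays exponentially. -/
def decaySubmodule (A : Matrix δ δ ℂ) : Submodule ℂ (δ → ℂ) where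
  carrier := {v | ∃ a : ℝ, 0 < a ∧ ∀ i,
    (fun t : ℝ => (NormedSpace.exp ((t : ℂ) • A) *ᵥ v) i) =O[atTop] fun t : ℝ => Real.exp (-a * t)}
  add_mem' := by
    rintro v w ⟨a, ha, hv⟩ ⟨b, hb, hw⟩
    refine ⟨min a b, lt_min ha hb, fun i => ?_⟩
    simp only [Matrix.mulVec_add, Pi.add_apply]
    exact ((hv i).trans (isBigO_exp_neg_of_le (min_le_left _ _))).add
      ((hw i).trans (isBigO_exp_neg_of_le (min_le_right _ _)))
  zero_mem' := ⟨1, one_pos, fun i => by simpa using isBigO_zero _ _⟩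
  smul_mem' := by
    rintro c v ⟨a, ha, hv⟩
    refine ⟨a, ha, fun i => ?_⟩
    simp only [Matrix.mulVec_smul, Pi.smul_apply, smul_eq_mul]
    exact (hv i).const_mul_left c

theorem decaySubmodule_eq_top (A : Matrix δ δ ℂ) (hA : ∀ z ∈ spectrum ℂ A, z.re < 0) :
    decaySubmodule A = ⊤ := by
  rw [eq_top_iff, ← Module.End.iSup_maxGenEigenspace_eq_top (Matrix.toLin' A)]
  refine iSup_le fun μ v hv => ?_
  by_cases hv0 : v = 0
  · rw [hv0]; exact Submodule.zero_mem _
  obtain ⟨k, hk⟩ := (Module.End.mem_maxGenEigenspace _ _ _).1 hv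
  have hμ : μ.re < 0 := by
    refine hA μ ?_
    rw [← Matrix.spectrum_toLin', ← Module.End.hasEigenvalue_iff_mem_spectrum]
    have : Module.End.HasUnifEigenvalue (Matrix.toLin' A) μ ⊤ := by
      intro h
      have hv' : v ∈ Module.End.maxGenEigenspace (Matrix.toLin' A) μ := hv
      change v ∈ Module.End.genEigenspace (Matrix.toLin' A) μ ⊤ at hv'
      rw [h] at hv'
      exact hv0 (by simpa using hv')
    exact this.lt (by simp)
  have hk' : (A - μ • 1) ^ k *ᵥ v = 0 := by
    have e : Matrix.toLin' A - μ • 1 = Matrix.toLin' (A - μ • 1) := by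
      simp [Matrix.toLin'_one, Module.End.one_eq_id]
    rw [e, ← Matrix.toLin'_pow, Matrix.toLin'_apply] at hk
    exact hk
  refine ⟨-μ.re / 2, by linarith, fun i => ?_⟩
  have e : (fun t : ℝ => (NormedSpace.exp ((t : ℂ) • A) *ᵥ v) i) = fun t : ℝ =>
      ∑ j ∈ Finset.range k, Complex.exp (t * μ) *
        (((j.factorial : ℂ)⁻¹ * (((A - μ • 1) ^ j) *ᵥ v) i) * (t : ℂ) ^ j) := by
    funext t
    rw [exp_mulVec_eq_exp_shift A μ, exp_smul_mulVec_of_pow_mulVec_eq_zero _ _ _ hk']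
    simp only [Pi.smul_apply, smul_eq_mul, Finset.sum_apply, Finset.mul_sum]
    refine Finset.sum_congr rfl fun j _ => ?_
    ring
  rw [e]
  exact IsBigO.fun_sum fun j _ => isBigO_pow_mul_exp hμ _ j

/-- The flow of a stable matrix decays exponentially, entry by entry. -/
theorem IsStable.exists_isBigO {A : Matrix δ δ ℝ} (hA : IsStable A) :
    ∃ a : ℝ, 0 < a ∧ ∀ i j, (fun t : ℝ => NormedSpace.exp (t • A) i j) =O[atTop]
      fun t : ℝ => Real.exp (-a * t) := by
  have h : ∀ j, ∃ a : ℝ, 0 < a ∧ ∀ i, (fun t : ℝ => NormedSpace.exp (t • A) i j) =O[atTop]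
      fun t : ℝ => Real.exp (-a * t) := by
    intro j
    have hj : (Pi.single j 1 : δ → ℂ) ∈ decaySubmodule (A.map (algebraMap ℝ ℂ)) := by
      rw [decaySubmodule_eq_top _ hA]; trivial
    obtain ⟨a, ha, h⟩ := hj
    refine ⟨a, ha, fun i => ?_⟩
    refine IsBigO.of_norm_left ?_
    have e : (fun t : ℝ => ‖NormedSpace.exp (t • A) i j‖) = fun t : ℝ =>
        ‖(NormedSpace.exp ((t : ℂ) • A.map (algebraMap ℝ ℂ)) *ᵥ Pi.single j 1) i‖ := by
      funext t
      rw [← exp_map_ofReal, Matrix.mulVec_single_one]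
      simp
    rw [e]
    exact (h i).norm_left
  choose a ha h using h
  rcases isEmpty_or_nonempty δ with hδ | hδ
  · exact ⟨1, one_pos, fun i => (hδ.false i).elim⟩
  · refine ⟨Finset.univ.inf' Finset.univ_nonempty a, ?_, fun i j => (h j i).trans
      (isBigO_exp_neg_of_le (Finset.inf'_le _ (Finset.mem_univ j)))⟩
    rw [Finset.lt_inf'_iff]
    exact fun j _ => ha j

end Exponential

/-! ### Calculus of matrix-valued functions -/

section Calculus

variable {ι κ μ δ : Type*} [Fintype ι] [Fintype κ] [Fintype μ] [Fintype δ] [DecidableEq δ]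

/-- Entrywise derivative of a matrix-valued function, independent of a choice of matrix norm. -/
def HasMatDeriv {ι κ : Type*} (M : ℝ → Matrix ι κ ℝ) (M' : Matrix ι κ ℝ) (t : ℝ) : Prop :=
  ∀ i j, HasDerivAt (fun τ => M τ i j) (M' i j) t

omit [Fintype ι] [Fintype μ] in
theorem HasMatDeriv.mul {M : ℝ → Matrix ι κ ℝ} {N : ℝ → Matrix κ μ ℝ} {M' : Matrix ι κ ℝ}
    {N' : Matrix κ μ ℝ} {t : ℝ} (hM : HasMatDeriv M M' t) (hN : HasMatDeriv N N' t) :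
    HasMatDeriv (fun τ => M τ * N τ) (M' * N t + M t * N') t := by
  intro i j
  simp only [Matrix.mul_apply, Matrix.add_apply, ← Finset.sum_add_distrib]
  exact HasDerivAt.fun_sum fun k _ => (hM i k).mul (hN k j)

omit [Fintype ι] [Fintype κ] in
theorem hasMatDeriv_const (M : Matrix ι κ ℝ) (t : ℝ) : HasMatDeriv (fun _ => M) 0 t :=
  fun i j => hasDerivAt_const t (M i j)

omit [Fintype ι] [Fintype κ] in
theorem HasMatDeriv.transpose {M : ℝ → Matrix ι κ ℝ} {M' : Matrix ι κ ℝ} {t : ℝ}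
    (hM : HasMatDeriv M M' t) : HasMatDeriv (fun τ => (M τ)ᵀ) M'ᵀ t :=
  fun i j => hM j i

theorem HasMatDeriv.trace {M : ℝ → Matrix ι ι ℝ} {M' : Matrix ι ι ℝ} {t : ℝ}
    (hM : HasMatDeriv M M' t) : HasDerivAt (fun τ => (M τ).trace) M'.trace t := by
  simp only [Matrix.trace, Matrix.diag]
  exact HasDerivAt.fun_sum fun i _ => hM i i

open scoped Matrix.Norms.Operator in
theorem hasMatDeriv_exp (A : Matrix δ δ ℝ) (t : ℝ) :
    HasMatDeriv (fun τ => NormedSpace.exp (τ • A)) (A * NormedSpace.exp (t • A)) t := by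
  intro i j
  have h := hasDerivAt_exp_smul_const' (𝕂 := ℝ) A t
  let entry := LinearMap.toContinuousLinearMap (Matrix.entryLinearMap ℝ ℝ i j)
  exact entry.hasFDerivAt.comp_hasDerivAt t h

omit [Fintype μ] in
theorem hasMatDeriv_exp_mul (A : Matrix δ δ ℝ) (x : Matrix δ μ ℝ) (t : ℝ) :
    HasMatDeriv (fun τ => NormedSpace.exp (τ • A) * x) (A * (NormedSpace.exp (t • A) * x)) t := by
  have := (hasMatDeriv_exp A t).mul (hasMatDeriv_const x t)
  simpa only [Matrix.mul_zero, add_zero, Matrix.mul_assoc] using this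

theorem exp_smul_transpose (A : Matrix δ δ ℝ) (t : ℝ) :
    NormedSpace.exp (t • Aᵀ) = (NormedSpace.exp (t • A))ᵀ := by
  rw [← Matrix.exp_transpose, Matrix.transpose_smul]

end Calculus

/-! ### Lyapunov equations of the Gramians -/

section Lyapunov

variable {δ ο : Type*} [Fintype δ] [DecidableEq δ] [Fintype ο] [DecidableEq ο]

theorem IsStable.transpose {A : Matrix δ δ ℝ} (hA : IsStable A) : IsStable Aᵀ := by
  intro z hz
  refine hA z ?_
  rw [Matrix.transpose_map, spectrum.mem_iff] at hz
  rw [spectrum.mem_iff]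
  contrapose! hz
  rw [Matrix.isUnit_iff_isUnit_det] at hz ⊢
  rw [← Matrix.det_transpose] at hz
  simpa [Matrix.transpose_sub, Matrix.algebraMap_eq_diagonal] using hz

theorem tendsto_exp_neg_mul {a : ℝ} (ha : 0 < a) :
    Tendsto (fun t : ℝ => Real.exp (-a * t)) atTop (𝓝 0) :=
  Real.tendsto_exp_atBot.comp (tendsto_id.const_mul_atTop_of_neg (neg_lt_zero.mpr ha))

/-- The reachability Gramian of a stable matrix solves its Lyapunov equation. -/
theorem reachGramian_lyapunov {A : Matrix δ δ ℝ} (hA : IsStable A) (K : Matrix δ δ ℝ) :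
    A * reachGramian A K + reachGramian A K * Aᵀ + K = 0 := by
  obtain ⟨a, ha, hO⟩ := hA.exists_isBigO
  set N : ℝ → Matrix δ δ ℝ :=
    fun t => NormedSpace.exp (t • A) * K * NormedSpace.exp (t • Aᵀ) with hN
  have hNO : ∀ i j, (fun t => N t i j) =O[atTop] fun t : ℝ => Real.exp (-(a + a) * t) := by
    intro i j
    simp only [hN, exp_smul_transpose, Matrix.mul_apply, Matrix.transpose_apply]
    refine IsBigO.fun_sum fun k _ => ?_
    have e : (fun t : ℝ => Real.exp (-(a + a) * t)) =
        fun t => Real.exp (-a * t) * Real.exp (-a * t) := by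
      funext t; rw [← Real.exp_add]; ring_nf
    rw [e]
    refine IsBigO.mul (IsBigO.fun_sum fun l _ => ?_) (hO j k)
    simp only [mul_comm _ (K l k)]
    exact (hO i l).const_mul_left _
  have hND : ∀ t, HasMatDeriv N (A * N t + N t * Aᵀ) t := by
    intro t
    have h := ((hasMatDeriv_exp A t).mul (hasMatDeriv_const K t)).mul
      (hasMatDeriv_exp A t).transpose
    simp only [hN, exp_smul_transpose]
    convert h using 1
    simp only [Matrix.transpose_mul, Matrix.mul_assoc, Matrix.mul_zero, add_zero]
  have hNc : ∀ i j, Continuous fun t => N t i j := fun i j =>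
    continuous_iff_continuousAt.2 fun t => (hND t i j).continuousAt
  have hNI : ∀ i j, IntegrableOn (fun t => N t i j) (Set.Ioi 0) := fun i j =>
    integrable_of_isBigO_exp_neg (by linarith) (hNc i j).continuousOn (hNO i j)
  have hN0 : N 0 = K := by simp [hN]
  ext i j
  have hlim : Tendsto (fun t => N t i j) atTop (𝓝 0) :=
    (hNO i j).trans_tendsto (tendsto_exp_neg_mul (by linarith))
  have e1 : ∀ t, (A * N t + N t * Aᵀ) i j =
      (∑ k, A i k * N t k j) + ∑ k, N t i k * Aᵀ k j := fun t => by
    simp only [Matrix.add_apply, Matrix.mul_apply]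
  have i1 : ∀ k ∈ Finset.univ, IntegrableOn (fun t => A i k * N t k j) (Set.Ioi 0) :=
    fun k _ => (hNI k j).const_mul _
  have i2 : ∀ k ∈ Finset.univ, IntegrableOn (fun t => N t i k * Aᵀ k j) (Set.Ioi 0) :=
    fun k _ => (hNI i k).mul_const _
  have hI : IntegrableOn (fun t => (A * N t + N t * Aᵀ) i j) (Set.Ioi 0) := by
    simp only [e1]
    exact (integrable_finsetSum _ i1).add (integrable_finsetSum _ i2)
  have h := integral_Ioi_of_hasDerivAt_of_tendsto (hNc i j).continuousWithinAt
    (fun t _ => hND t i j) hI hlim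
  simp only [e1] at h
  rw [integral_add (integrable_finsetSum _ i1) (integrable_finsetSum _ i2),
    integral_finsetSum _ i1, integral_finsetSum _ i2, hN0] at h
  simp only [integral_const_mul, integral_mul_const] at h
  have hP : ∀ i j, reachGramian A K i j = ∫ t in Set.Ioi 0, N t i j := fun i j => rfl
  simp only [Matrix.add_apply, Matrix.mul_apply, Matrix.zero_apply, hP]
  rw [h]
  ring

theorem obsGramian_lyapunov {A : Matrix δ δ ℝ} (hA : IsStable A) (C : Matrix ο δ ℝ)
    (Ge : Matrix ο ο ℝ) :
    Aᵀ * obsGramian A C Ge + obsGramian A C Ge * A + Cᵀ * Ge⁻¹ * C = 0 := by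
  have e : obsGramian A C Ge = reachGramian Aᵀ (Cᵀ * Ge⁻¹ * C) := by
    simp only [obsGramian, reachGramian, Matrix.transpose_transpose, Matrix.mul_assoc]
  have := reachGramian_lyapunov hA.transpose (Cᵀ * Ge⁻¹ * C)
  rwa [← e, Matrix.transpose_transpose] at this

end Lyapunov

/-! ### Energy of the output error -/

section Energy

variable {δ ρ ο ς : Type*} [Fintype δ] [DecidableEq δ] [Fintype ρ] [DecidableEq ρ] [Fintype ο]
  [Fintype ς]

/-- The trace pairing of two flows along a solution of a Sylvester equation. -/
theorem hasDerivAt_trace_sylvester {A : Matrix δ δ ℝ} {B : Matrix ρ ρ ℝ} {S K : Matrix δ ρ ℝ}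
    (h : Aᵀ * S + S * B + K = 0) (x : Matrix δ ς ℝ) (y : Matrix ρ ς ℝ) (t : ℝ) :
    HasDerivAt (fun τ => ((NormedSpace.exp (τ • A) * x)ᵀ * S * (NormedSpace.exp (τ • B) * y)).trace)
      (-((NormedSpace.exp (t • A) * x)ᵀ * K * (NormedSpace.exp (t • B) * y)).trace) t := by
  have hd := ((((hasMatDeriv_exp_mul A x t).transpose).mul (hasMatDeriv_const S t)).mul
    (hasMatDeriv_exp_mul B y t)).trace
  refine hd.congr_deriv ?_
  symm
  have hK : K = -(Aᵀ * S + S * B) := by rw [eq_neg_iff_add_eq_zero, add_comm]; exact h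
  rw [← Matrix.trace_neg, hK]
  congr 1
  rw [Matrix.transpose_mul A]
  simp only [Matrix.mul_neg, Matrix.neg_mul, neg_neg, Matrix.mul_add, Matrix.add_mul,
    Matrix.mul_zero, add_zero, Matrix.mul_assoc]

omit [DecidableEq δ] [DecidableEq ρ] in
theorem trace_transpose_mul_self (M : Matrix ο ς ℝ) : (Mᵀ * M).trace = frobNorm M ^ 2 := by
  rw [frobNorm_sq, Finset.sum_comm]
  simp only [Matrix.trace, Matrix.diag, Matrix.mul_apply, Matrix.transpose_apply, sq]

/-- The quadratic form of `[[Q, -S], [-Sᵀ, T]]`, the observability Gramian of the error system,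
summed over the columns of the matrices `x` and `y` of initial states. -/
def errorForm (Q : Matrix δ δ ℝ) (S : Matrix δ ρ ℝ) (T : Matrix ρ ρ ℝ) (x : Matrix δ ς ℝ)
    (y : Matrix ρ ς ℝ) : ℝ :=
  (xᵀ * Q * x).trace - 2 * (xᵀ * S * y).trace + (yᵀ * T * y).trace

theorem hasDerivAt_errorForm {A Q : Matrix δ δ ℝ} {B T : Matrix ρ ρ ℝ} {S : Matrix δ ρ ℝ}
    {H : Matrix ο δ ℝ} {K : Matrix ο ρ ℝ} (hQ : Aᵀ * Q + Q * A + Hᵀ * H = 0)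
    (hS : Aᵀ * S + S * B + Hᵀ * K = 0) (hT : Bᵀ * T + T * B + Kᵀ * K = 0)
    (x : Matrix δ ς ℝ) (y : Matrix ρ ς ℝ) (t : ℝ) :
    HasDerivAt
      (fun τ => errorForm Q S T (NormedSpace.exp (τ • A) * x) (NormedSpace.exp (τ • B) * y))
      (-frobNorm (H * (NormedSpace.exp (t • A) * x) -
        K * (NormedSpace.exp (t • B) * y)) ^ 2) t := by
  have h := ((hasDerivAt_trace_sylvester hQ x x t).sub
    ((hasDerivAt_trace_sylvester hS x y t).const_mul 2)).add (hasDerivAt_trace_sylvester hT y y t)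
  refine h.congr_deriv ?_
  rw [← trace_transpose_mul_self]
  generalize NormedSpace.exp (t • A) * x = F
  generalize NormedSpace.exp (t • B) * y = Y
  have e : (Yᵀ * (Kᵀ * (H * F))).trace = (Fᵀ * (Hᵀ * (K * Y))).trace := by
    rw [← Matrix.trace_transpose]
    simp only [Matrix.transpose_mul, Matrix.transpose_transpose, Matrix.mul_assoc]
  simp only [Matrix.transpose_sub, Matrix.transpose_mul, Matrix.sub_mul, Matrix.mul_sub,
    Matrix.trace_sub, Matrix.mul_assoc, e]
  ring

theorem antitone_errorForm {A Q : Matrix δ δ ℝ} {B T : Matrix ρ ρ ℝ} {S : Matrix δ ρ ℝ}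
    {H : Matrix ο δ ℝ} {K : Matrix ο ρ ℝ} (hQ : Aᵀ * Q + Q * A + Hᵀ * H = 0)
    (hS : Aᵀ * S + S * B + Hᵀ * K = 0) (hT : Bᵀ * T + T * B + Kᵀ * K = 0)
    (x : Matrix δ ς ℝ) (y : Matrix ρ ς ℝ) :
    Antitone fun τ : ℝ =>
      errorForm Q S T (NormedSpace.exp (τ • A) * x) (NormedSpace.exp (τ • B) * y) :=
  antitone_of_hasDerivAt_nonpos (fun t => hasDerivAt_errorForm hQ hS hT x y t)
    fun _ => neg_nonpos.mpr (sq_nonneg _)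

theorem trace_transpose_diagonal_mul (σ : ρ → ℝ) (y : Matrix ρ ς ℝ) :
    (yᵀ * Matrix.diagonal σ * y).trace = ∑ j, ∑ i, σ i * y i j ^ 2 := by
  simp only [Matrix.trace, Matrix.diag]
  refine Finset.sum_congr rfl fun j _ => ?_
  rw [Matrix.mul_apply]
  refine Finset.sum_congr rfl fun i _ => ?_
  rw [Matrix.mul_diagonal, Matrix.transpose_apply]
  ring

/-- A positive definite solution of the observability Lyapunov equation keeps the flow bounded,
even when the flow does not decay. -/
theorem bounded_flow_of_lyapunov {B : Matrix ρ ρ ℝ} {σ : ρ → ℝ} {K : Matrix ο ρ ℝ}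
    (hσ : ∀ i, 0 < σ i)
    (hT : Bᵀ * Matrix.diagonal σ + Matrix.diagonal σ * B + Kᵀ * K = 0) (y : Matrix ρ ς ℝ)
    (i : ρ) (j : ς) :
    IsBoundedUnder (· ≤ ·) atTop fun t : ℝ => ‖(NormedSpace.exp (t • B) * y) i j‖ := by
  -- the error form without a full system is the Lyapunov function `tr (Yᵀ Σ Y)`
  have hanti := antitone_errorForm (A := (0 : Matrix ρ ρ ℝ)) (Q := 0) (S := (0 : Matrix ρ ρ ℝ))
    (H := (0 : Matrix ο ρ ℝ)) (by simp) (by simp) hT (0 : Matrix ρ ς ℝ) y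
  simp only [errorForm, Matrix.mul_zero, Matrix.zero_mul, Matrix.transpose_zero, Matrix.trace_zero,
    mul_zero, sub_zero, zero_add, trace_transpose_diagonal_mul] at hanti
  set c := ∑ j, ∑ i, σ i * (NormedSpace.exp ((0 : ℝ) • B) * y) i j ^ 2 with hc
  refine isBoundedUnder_of_eventually_le (a := Real.sqrt (c / σ i)) ?_
  filter_upwards [eventually_ge_atTop 0] with t ht
  have h1 := hanti ht
  refine Real.le_sqrt_of_sq_le ?_
  rw [le_div_iff₀ (hσ i), Real.norm_eq_abs, sq_abs, mul_comm]
  refine le_trans ?_ h1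
  have nn : ∀ j i, 0 ≤ σ i * (NormedSpace.exp (t • B) * y) i j ^ 2 := fun j i =>
    mul_nonneg (hσ i).le (sq_nonneg _)
  calc σ i * (NormedSpace.exp (t • B) * y) i j ^ 2
      ≤ ∑ i, σ i * (NormedSpace.exp (t • B) * y) i j ^ 2 :=
        Finset.single_le_sum (f := fun i => σ i * (NormedSpace.exp (t • B) * y) i j ^ 2)
          (fun i _ => nn j i) (Finset.mem_univ i)
    _ ≤ _ := Finset.single_le_sum
        (f := fun j => ∑ i, σ i * (NormedSpace.exp (t • B) * y) i j ^ 2)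
          (fun j _ => Finset.sum_nonneg fun i _ => nn j i) (Finset.mem_univ j)

omit [Fintype ς] in
theorem IsStable.tendsto_flow {A : Matrix δ δ ℝ} (hA : IsStable A) (x : Matrix δ ς ℝ) (i : δ)
    (j : ς) : Tendsto (fun t : ℝ => (NormedSpace.exp (t • A) * x) i j) atTop (𝓝 0) := by
  obtain ⟨a, ha, hO⟩ := hA.exists_isBigO
  simp only [Matrix.mul_apply]
  rw [← Finset.sum_const_zero (ι := δ) (s := Finset.univ)]
  refine tendsto_finsetSum _ fun k _ => ?_
  rw [← zero_mul (x k j)]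
  exact ((hO i k).trans_tendsto (tendsto_exp_neg_mul ha)).mul_const _

variable {A : Matrix δ δ ℝ} {R : Matrix δ δ ℝ} {B : Matrix ρ ρ ℝ} {σ : ρ → ℝ} {S : Matrix δ ρ ℝ}
    {H : Matrix ο δ ℝ} {K : Matrix ο ρ ℝ}

/-- The error form is nonnegative: it decreases along the flow, and only its nonnegative diagonal
blocks survive in the limit. -/
theorem errorForm_nonneg (hA : IsStable A) (hσ : ∀ i, 0 < σ i)
    (hQ : Aᵀ * (R * Rᵀ) + R * Rᵀ * A + Hᵀ * H = 0) (hS : Aᵀ * S + S * B + Hᵀ * K = 0)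
    (hT : Bᵀ * Matrix.diagonal σ + Matrix.diagonal σ * B + Kᵀ * K = 0)
    (x : Matrix δ ς ℝ) (y : Matrix ρ ς ℝ) :
    0 ≤ errorForm (R * Rᵀ) S (Matrix.diagonal σ) x y := by
  have hlim : Tendsto (fun t : ℝ => -(2 * ((NormedSpace.exp (t • A) * x)ᵀ * S *
      (NormedSpace.exp (t • B) * y)).trace)) atTop (𝓝 0) := by
    have : Tendsto (fun t : ℝ => ((NormedSpace.exp (t • A) * x)ᵀ * S *
      (NormedSpace.exp (t • B) * y)).trace) atTop (𝓝 0) := by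
      have h1 : ∀ j i, Tendsto (fun t : ℝ => ((NormedSpace.exp (t • A) * x)ᵀ * S) j i) atTop
          (𝓝 0) := by
        intro j i
        simp only [Matrix.mul_apply (M := (_ : Matrix ς δ ℝ)), Matrix.transpose_apply]
        rw [← Finset.sum_const_zero (ι := δ) (s := Finset.univ)]
        refine tendsto_finsetSum _ fun k _ => ?_
        rw [← zero_mul (S k i)]
        exact (hA.tendsto_flow x k j).mul_const _
      simp only [Matrix.trace, Matrix.diag, Matrix.mul_apply (M := (_ : Matrix ς ρ ℝ))]
      rw [← Finset.sum_const_zero (ι := ς) (s := Finset.univ)]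
      refine tendsto_finsetSum _ fun j _ => ?_
      rw [← Finset.sum_const_zero (ι := ρ) (s := Finset.univ)]
      refine tendsto_finsetSum _ fun i _ => ?_
      exact (h1 j i).zero_mul_isBoundedUnder_le (bounded_flow_of_lyapunov hσ hT y i j)
    simpa using (this.const_mul 2).neg
  refine le_of_tendsto hlim ?_
  filter_upwards [eventually_ge_atTop 0] with t ht
  have h0 := antitone_errorForm hQ hS hT x y ht
  simp only [zero_smul, NormedSpace.exp_zero, Matrix.one_mul] at h0
  refine le_trans ?_ h0
  have h1 : 0 ≤ ((NormedSpace.exp (t • A) * x)ᵀ * (R * Rᵀ) *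
      (NormedSpace.exp (t • A) * x)).trace := by
    have e : (NormedSpace.exp (t • A) * x)ᵀ * (R * Rᵀ) * (NormedSpace.exp (t • A) * x) =
        (Rᵀ * (NormedSpace.exp (t • A) * x))ᵀ * (Rᵀ * (NormedSpace.exp (t • A) * x)) := by
      simp only [Matrix.transpose_mul, Matrix.transpose_transpose, Matrix.mul_assoc]
    rw [e, trace_transpose_mul_self]
    positivity
  have h2 : 0 ≤ ((NormedSpace.exp (t • B) * y)ᵀ * Matrix.diagonal σ *
      (NormedSpace.exp (t • B) * y)).trace := by
    rw [trace_transpose_diagonal_mul]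
    exact Finset.sum_nonneg fun j _ => Finset.sum_nonneg fun i _ =>
      mul_nonneg (hσ i).le (sq_nonneg _)
  unfold errorForm
  linarith

theorem continuous_frobNorm_sq_output (x : Matrix δ ς ℝ) (y : Matrix ρ ς ℝ) :
    Continuous fun t : ℝ => frobNorm (H * (NormedSpace.exp (t • A) * x) -
      K * (NormedSpace.exp (t • B) * y)) ^ 2 := by
  have h1 : ∀ i j, Continuous fun t : ℝ => (NormedSpace.exp (t • A) * x) i j := fun i j =>
    continuous_iff_continuousAt.2 fun t => (hasMatDeriv_exp_mul A x t i j).continuousAt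
  have h2 : ∀ i j, Continuous fun t : ℝ => (NormedSpace.exp (t • B) * y) i j := fun i j =>
    continuous_iff_continuousAt.2 fun t => (hasMatDeriv_exp_mul B y t i j).continuousAt
  simp only [frobNorm_sq, Matrix.sub_apply, Matrix.mul_apply (M := H), Matrix.mul_apply (M := K)]
  refine continuous_finsetSum _ fun i _ => continuous_finsetSum _ fun j _ => Continuous.pow ?_ 2
  exact (continuous_finsetSum _ fun k _ => (h1 k j).const_mul _).sub
    (continuous_finsetSum _ fun k _ => (h2 k j).const_mul _)

theorem integral_le_of_hasDerivAt_neg {f g : ℝ → ℝ} {τ : ℝ} (hf : ∀ t, HasDerivAt f (-g t) t)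
    (hg : Continuous g) (h0 : 0 ≤ f τ) : ∫ t in (0 : ℝ)..τ, g t ≤ f 0 := by
  have h := intervalIntegral.integral_eq_sub_of_hasDerivAt (fun t _ => hf t)
    (hg.neg.intervalIntegrable 0 τ)
  rw [intervalIntegral.integral_neg] at h
  linarith

/-- On every finite horizon, the energy of the output error is at most the error form of the
initial states. -/
theorem integral_output_error_le (hA : IsStable A) (hσ : ∀ i, 0 < σ i)
    (hQ : Aᵀ * (R * Rᵀ) + R * Rᵀ * A + Hᵀ * H = 0) (hS : Aᵀ * S + S * B + Hᵀ * K = 0)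
    (hT : Bᵀ * Matrix.diagonal σ + Matrix.diagonal σ * B + Kᵀ * K = 0)
    (x : Matrix δ ς ℝ) (y : Matrix ρ ς ℝ) (τ : ℝ) :
    ∫ t in (0 : ℝ)..τ, frobNorm (H * (NormedSpace.exp (t • A) * x) -
      K * (NormedSpace.exp (t • B) * y)) ^ 2 ≤ errorForm (R * Rᵀ) S (Matrix.diagonal σ) x y := by
  have h0 := errorForm_nonneg hA hσ hQ hS hT (NormedSpace.exp (τ • A) * x)
    (NormedSpace.exp (τ • B) * y)
  refine (integral_le_of_hasDerivAt_neg (fun t => hasDerivAt_errorForm hQ hS hT x y t)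
    (continuous_frobNorm_sq_output x y) h0).trans_eq ?_
  rw [zero_smul, zero_smul, NormedSpace.exp_zero, NormedSpace.exp_zero, Matrix.one_mul,
    Matrix.one_mul]

end Energy

section Kernel

variable {δ ρ ο ς : Type*} [Fintype δ] [DecidableEq δ] [Fintype ρ] [DecidableEq ρ] [Fintype ο]
  [Fintype ς]
variable {A : Matrix δ δ ℝ} {R : Matrix δ δ ℝ} {B : Matrix ρ ρ ℝ} {σ : ρ → ℝ} {S : Matrix δ ρ ℝ}
    {H : Matrix ο δ ℝ} {K : Matrix ο ρ ℝ}

/-- Directions that are unobservable for the full system are annihilated by the solution of the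
Sylvester equation, because the error form is positive semidefinite. -/
theorem sylvester_transpose_mul_eq_zero (hA : IsStable A) (hσ : ∀ i, 0 < σ i)
    (hQ : Aᵀ * (R * Rᵀ) + R * Rᵀ * A + Hᵀ * H = 0) (hS : Aᵀ * S + S * B + Hᵀ * K = 0)
    (hT : Bᵀ * Matrix.diagonal σ + Matrix.diagonal σ * B + Kᵀ * K = 0)
    {x : Matrix δ ς ℝ} (hx : Rᵀ * x = 0) : Sᵀ * x = 0 := by
  set y := Sᵀ * x with hy
  have hyx : xᵀ * S = yᵀ := by rw [hy, Matrix.transpose_mul, Matrix.transpose_transpose]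
  set b := (yᵀ * Matrix.diagonal σ * y).trace
  -- the form is affine in the scaling `c` of `x`, so its slope has to vanish
  have h : ∀ c : ℝ, 0 ≤ -(2 * (c * frobNorm y ^ 2)) + b := by
    intro c
    have := errorForm_nonneg hA hσ hQ hS hT (c • x) y
    have h1 : (c • x)ᵀ * (R * Rᵀ) * (c • x) = 0 := by
      rw [Matrix.mul_assoc, Matrix.mul_assoc R, Matrix.mul_smul, hx]; simp
    have h2 : ((c • x)ᵀ * S * y).trace = c * frobNorm y ^ 2 := by
      rw [Matrix.transpose_smul, Matrix.smul_mul, hyx, Matrix.smul_mul, Matrix.trace_smul,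
        trace_transpose_mul_self, smul_eq_mul]
    rw [errorForm, h1, h2, Matrix.trace_zero, zero_sub] at this
    exact this
  have h0 : frobNorm y ^ 2 = 0 := by
    generalize frobNorm y ^ 2 = w at h
    by_contra hne
    have := h ((b + 1) / (2 * w))
    rw [show 2 * ((b + 1) / (2 * w) * w) = b + 1 by field_simp] at this
    linarith
  exact frobNorm_eq_zero.1 (pow_eq_zero_iff two_ne_zero |>.1 h0)

end Kernel

/-! ### Algebra of balanced coordinates -/

section BalancedBlocks

variable {ρ θ ς : Type*} [Fintype ρ] [Fintype θ] [Fintype ς]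

/-- The trace identity behind the balanced truncation error formula, for the blocks of a system
whose Gramians are both equal to `diag(T₁, T₂)`. -/
theorem balanced_trace_identity {A₁ T₁ K₁ S₁ : Matrix ρ ρ ℝ} {A₂ : Matrix ρ θ ℝ} {A₃ : Matrix θ ρ ℝ}
    {T₂ : Matrix θ θ ℝ} {S₂ : Matrix θ ρ ℝ} {B₁ : Matrix ρ ς ℝ} {B₂ : Matrix θ ς ℝ}
    (hreach₁ : A₁ * T₁ + T₁ * A₁ᵀ + B₁ * B₁ᵀ = 0)
    (hreach₂ : A₂ * T₂ + T₁ * A₃ᵀ + B₁ * B₂ᵀ = 0)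
    (hobs : A₁ᵀ * T₁ + T₁ * A₁ + K₁ = 0)
    (hsylv : A₁ᵀ * S₁ + A₃ᵀ * S₂ + S₁ * A₁ + K₁ = 0) :
    (B₁ᵀ * T₁ * B₁).trace + (B₂ᵀ * T₂ * B₂).trace
        - 2 * ((B₁ᵀ * S₁ * B₁).trace + (B₂ᵀ * S₂ * B₁).trace) + (B₁ᵀ * T₁ * B₁).trace =
      ((B₂ * B₂ᵀ + (2 : ℝ) • (S₂ * A₂)) * T₂).trace := by
  have c1 : (B₁ᵀ * T₁ * B₁).trace = (B₁ * B₁ᵀ * T₁).trace := Matrix.trace_mul_cycle _ _ _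
  have c2 : (B₂ᵀ * T₂ * B₂).trace = (B₂ * B₂ᵀ * T₂).trace := Matrix.trace_mul_cycle _ _ _
  have c3 : (B₁ᵀ * S₁ * B₁).trace = (B₁ * B₁ᵀ * S₁).trace := Matrix.trace_mul_cycle _ _ _
  have c4 : (B₂ᵀ * S₂ * B₁).trace = (B₁ * B₂ᵀ * S₂).trace := Matrix.trace_mul_cycle _ _ _
  have e1 := congrArg (fun M => (M * T₁).trace) hreach₁
  have e2 := congrArg (fun M => (M * S₁).trace) hreach₁
  have e3 := congrArg (fun M => (M * S₂).trace) hreach₂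
  have e4 := congrArg (fun M => (M * T₁).trace) hobs
  have e5 := congrArg (fun M => (M * T₁).trace) hsylv
  simp only [Matrix.add_mul, Matrix.trace_add, Matrix.zero_mul, Matrix.trace_zero] at e1 e2 e3 e4 e5
  have d1 : (A₁ * T₁ * T₁).trace = (T₁ * A₁ * T₁).trace := Matrix.trace_mul_cycle _ _ _
  have d2 : (T₁ * A₁ᵀ * T₁).trace = (A₁ᵀ * T₁ * T₁).trace := (Matrix.trace_mul_cycle _ _ _).symm
  have d3 : (A₁ᵀ * S₁ * T₁).trace = (T₁ * A₁ᵀ * S₁).trace := Matrix.trace_mul_cycle _ _ _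
  have d4 : (A₃ᵀ * S₂ * T₁).trace = (T₁ * A₃ᵀ * S₂).trace := Matrix.trace_mul_cycle _ _ _
  have d5 : (S₁ * A₁ * T₁).trace = (A₁ * T₁ * S₁).trace := (Matrix.trace_mul_cycle _ _ _).symm
  have d6 : (S₂ * A₂ * T₂).trace = (A₂ * T₂ * S₂).trace := (Matrix.trace_mul_cycle _ _ _).symm
  rw [Matrix.add_mul, Matrix.trace_add, Matrix.smul_mul, Matrix.trace_smul, smul_eq_mul, c1, c2, c3,
    c4]
  linarith

end BalancedBlocks

section Balancing

variable {d s : ℕ} {P Q L R U Z : Matrix (Fin d) (Fin d) ℝ} {σ : Fin d → ℝ}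

theorem inv_sqrt_mul_inv_sqrt_mul_sq {a : ℝ} (ha : 0 ≤ a) :
    a * ((Real.sqrt a)⁻¹ * ((Real.sqrt a)⁻¹ * a)) = a := by
  rcases ha.eq_or_lt with rfl | ha
  · simp
  · rw [← mul_assoc (Real.sqrt a)⁻¹, ← mul_inv, Real.mul_self_sqrt ha.le, inv_mul_cancel₀ ha.ne',
      mul_one]

theorem IsBalancing.symm (h : IsBalancing P Q L R U Z σ) : IsBalancing Q P R L Z U σ where
  reach_factor := h.obs_factor
  obs_factor := h.reach_factor
  left_orthogonal := h.right_orthogonal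
  right_orthogonal := h.left_orthogonal
  svd := by
    have := congrArg Matrix.transpose h.svd
    simpa [Matrix.transpose_mul, Matrix.mul_assoc] using this
  nonneg := h.nonneg
  antitone := h.antitone

theorem orthogonal_transpose_mul {X : Matrix (Fin d) (Fin d) ℝ}
    (h : X ∈ Matrix.orthogonalGroup (Fin d) ℝ) : Xᵀ * X = 1 := by
  exact (Matrix.mem_orthogonalGroup_iff' (Fin d) ℝ).1 h

/-- The reachability Gramian maps the dual balancing basis to the scaled balancing basis. -/
theorem IsBalancing.reach_mul_balBasis (h : IsBalancing P Q L R U Z σ) :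
    P * balBasis R U σ = balBasis L Z σ * Matrix.diagonal σ := by
  have hs := h.symm.svd
  rw [h.reach_factor, balBasis, balBasis]
  calc L * Lᵀ * (R * U * Matrix.diagonal fun i => (Real.sqrt (σ i))⁻¹)
      = L * (Lᵀ * R) * U * Matrix.diagonal (fun i => (Real.sqrt (σ i))⁻¹) := by
        simp only [Matrix.mul_assoc]
    _ = L * Z * Matrix.diagonal σ * (Uᵀ * U) * Matrix.diagonal (fun i => (Real.sqrt (σ i))⁻¹) := by
        rw [hs]; simp only [Matrix.mul_assoc]
    _ = L * Z * (Matrix.diagonal σ * Matrix.diagonal (fun i => (Real.sqrt (σ i))⁻¹)) := by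
        rw [orthogonal_transpose_mul h.left_orthogonal, Matrix.mul_one, Matrix.mul_assoc]
    _ = L * Z * (Matrix.diagonal (fun i => (Real.sqrt (σ i))⁻¹) * Matrix.diagonal σ) := by
        simp only [Matrix.diagonal_mul_diagonal, mul_comm]
    _ = _ := by simp only [Matrix.mul_assoc]

theorem IsBalancing.balBasis_transpose_mul_balBasis (h : IsBalancing P Q L R U Z σ) :
    (balBasis R U σ)ᵀ * balBasis L Z σ = Matrix.diagonal (fun i => (Real.sqrt (σ i))⁻¹) *
      (Matrix.diagonal σ * Matrix.diagonal (fun i => (Real.sqrt (σ i))⁻¹)) := by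
  rw [balBasis, balBasis, Matrix.transpose_mul, Matrix.transpose_mul, Matrix.diagonal_transpose]
  calc _ = Matrix.diagonal (fun i => (Real.sqrt (σ i))⁻¹) * (Uᵀ * (Rᵀ * L) * Z *
        Matrix.diagonal (fun i => (Real.sqrt (σ i))⁻¹)) := by simp only [Matrix.mul_assoc]
    _ = Matrix.diagonal (fun i => (Real.sqrt (σ i))⁻¹) * ((Uᵀ * U) * Matrix.diagonal σ * (Zᵀ * Z) *
        Matrix.diagonal (fun i => (Real.sqrt (σ i))⁻¹)) := by
          rw [h.svd]; simp only [Matrix.mul_assoc]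
    _ = _ := by
      rw [orthogonal_transpose_mul h.left_orthogonal, orthogonal_transpose_mul h.right_orthogonal,
        Matrix.one_mul, Matrix.mul_one]

theorem IsBalancing.balBasis_transpose_mul_obs_mul (h : IsBalancing P Q L R U Z σ) :
    (balBasis L Z σ)ᵀ * Q * balBasis L Z σ = Matrix.diagonal σ := by
  rw [Matrix.mul_assoc, h.symm.reach_mul_balBasis, ← Matrix.mul_assoc,
    h.symm.balBasis_transpose_mul_balBasis]
  simp only [Matrix.diagonal_mul_diagonal]
  congr 1
  funext i
  have := inv_sqrt_mul_inv_sqrt_mul_sq (h.nonneg i)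
  linarith

/-- The oblique projection onto the balancing basis is the identity on the reachable space, up to
unobservable directions. -/
theorem IsBalancing.proj_mul_factor (h : IsBalancing P Q L R U Z σ) :
    Rᵀ * (1 - balBasis L Z σ * (balBasis R U σ)ᵀ) * L = 0 := by
  rw [Matrix.mul_sub, Matrix.sub_mul, Matrix.mul_one, sub_eq_zero]
  symm
  rw [balBasis, balBasis, Matrix.transpose_mul, Matrix.transpose_mul, Matrix.diagonal_transpose]
  set D := Matrix.diagonal (fun i => (Real.sqrt (σ i))⁻¹) with hD
  calc Rᵀ * (L * Z * D * (D * (Uᵀ * Rᵀ))) * L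
      = (Rᵀ * L) * Z * D * D * Uᵀ * (Rᵀ * L) := by simp only [Matrix.mul_assoc]
    _ = U * (Matrix.diagonal σ * (Zᵀ * Z) * D * D * (Uᵀ * U) * Matrix.diagonal σ) * Zᵀ := by
        rw [h.svd]; simp only [Matrix.mul_assoc]
    _ = U * (Matrix.diagonal σ * D * D * Matrix.diagonal σ) * Zᵀ := by
        rw [orthogonal_transpose_mul h.left_orthogonal, orthogonal_transpose_mul h.right_orthogonal,
          Matrix.mul_one, Matrix.mul_one]
    _ = U * Matrix.diagonal σ * Zᵀ := by
        congr 2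
        rw [hD]
        simp only [Matrix.diagonal_mul_diagonal]
        congr 1
        funext i
        have := inv_sqrt_mul_inv_sqrt_mul_sq (h.nonneg i)
        linarith
    _ = _ := h.svd.symm

theorem eq_zero_of_mul_transpose_self_eq_zero {α β : Type*} [Fintype α] [Fintype β]
    {M : Matrix α β ℝ} (h : M * Mᵀ = 0) : M = 0 := by
  rw [← Matrix.conjTranspose_eq_transpose_of_trivial, Matrix.self_mul_conjTranspose_eq_zero] at h
  exact h

/-- A left annihilator of the reachability Gramian annihilates the input matrix, and its product
with the system matrix is again a left annihilator. -/
theorem annihilates_of_lyapunov {α β δ : Type*} [Fintype α] [Fintype β] [Fintype δ]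
    {A L : Matrix δ δ ℝ} {B : Matrix δ β ℝ}
    (h : A * (L * Lᵀ) + L * Lᵀ * Aᵀ + B * Bᵀ = 0) {M : Matrix α δ ℝ} (hM : M * L = 0) :
    M * B = 0 ∧ M * A * L = 0 := by
  have hM' : Lᵀ * Mᵀ = 0 := by rw [← Matrix.transpose_mul, hM, Matrix.transpose_zero]
  have hB : M * B = 0 := by
    refine eq_zero_of_mul_transpose_self_eq_zero ?_
    have := congrArg (fun X => M * X * Mᵀ) h
    simp only [Matrix.mul_add, Matrix.add_mul, Matrix.mul_zero, Matrix.zero_mul] at this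
    have e1 : M * (A * (L * Lᵀ)) * Mᵀ = 0 := by simp only [Matrix.mul_assoc, hM', Matrix.mul_zero]
    have e2 : M * (L * Lᵀ * Aᵀ) * Mᵀ = 0 := by
      simp only [← Matrix.mul_assoc, hM, Matrix.zero_mul]
    rw [e1, e2, zero_add, zero_add] at this
    rw [Matrix.transpose_mul, ← this]
    simp only [Matrix.mul_assoc]
  refine ⟨hB, eq_zero_of_mul_transpose_self_eq_zero ?_⟩
  have := congrArg (fun X => M * X * (M * A)ᵀ) h
  simp only [Matrix.mul_add, Matrix.add_mul, Matrix.mul_zero, Matrix.zero_mul] at this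
  have e2 : M * (L * Lᵀ * Aᵀ) = 0 := by
    simp only [← Matrix.mul_assoc, hM, Matrix.zero_mul]
  have e3 : M * (B * Bᵀ) = 0 := by
    simp only [← Matrix.mul_assoc, hB, Matrix.zero_mul]
  rw [e2, e3, Matrix.zero_mul, add_zero, add_zero] at this
  rw [Matrix.transpose_mul, ← this]
  simp only [Matrix.mul_assoc]

/-- The Lyapunov equation in balanced coordinates. -/
theorem IsBalancing.lyapunov (h : IsBalancing P Q L R U Z σ) {A K : Matrix (Fin d) (Fin d) ℝ}
    (hP : A * P + P * Aᵀ + K = 0) :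
    (balBasis R U σ)ᵀ * A * balBasis L Z σ * Matrix.diagonal σ +
      Matrix.diagonal σ * ((balBasis R U σ)ᵀ * A * balBasis L Z σ)ᵀ +
      (balBasis R U σ)ᵀ * K * balBasis R U σ = 0 := by
  have h1 := h.reach_mul_balBasis
  have hPt : Pᵀ = P := by rw [h.reach_factor]; simp
  have h2 : (balBasis R U σ)ᵀ * P = Matrix.diagonal σ * (balBasis L Z σ)ᵀ := by
    have := congrArg Matrix.transpose h1
    rwa [Matrix.transpose_mul, Matrix.transpose_mul, hPt, Matrix.diagonal_transpose] at this
  generalize balBasis R U σ = V at *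
  generalize balBasis L Z σ = W at *
  have := congrArg (fun X => Vᵀ * X * V) hP
  simp only [Matrix.mul_add, Matrix.add_mul, Matrix.mul_zero, Matrix.zero_mul] at this
  rw [← this]
  congr 2
  · rw [Matrix.mul_assoc _ W, ← h1]; simp only [Matrix.mul_assoc]
  · rw [← Matrix.mul_assoc Vᵀ P, h2]
    simp only [Matrix.transpose_mul, Matrix.transpose_transpose, Matrix.mul_assoc]

end Balancing

section Blocks

variable {r q : ℕ} {α β : Type*}

theorem submatrix_mul_fin_add (M : Matrix α (Fin (r + q)) ℝ) (N : Matrix (Fin (r + q)) β ℝ)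
    {α' β' : Type*} (f : α' → α) (g : β' → β) :
    (M * N).submatrix f g =
      M.submatrix f (Fin.castAdd q) * N.submatrix (Fin.castAdd q) g +
        M.submatrix f (Fin.natAdd r) * N.submatrix (Fin.natAdd r) g := by
  ext i j
  simp [Matrix.mul_apply, Fin.sum_univ_add]

theorem diagonal_submatrix_castAdd (σ : Fin (r + q) → ℝ) :
    (Matrix.diagonal σ).submatrix (Fin.castAdd q) (Fin.castAdd q) =
      Matrix.diagonal fun i => σ (Fin.castAdd q i) := by
  ext i j; simp [Matrix.diagonal_apply, Fin.ext_iff]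

theorem diagonal_submatrix_natAdd (σ : Fin (r + q) → ℝ) :
    (Matrix.diagonal σ).submatrix (Fin.natAdd r) (Fin.natAdd r) =
      Matrix.diagonal fun i => σ (Fin.natAdd r i) := by
  ext i j; simp [Matrix.diagonal_apply, Fin.ext_iff]

theorem diagonal_submatrix_castAdd_natAdd (σ : Fin (r + q) → ℝ) :
    (Matrix.diagonal σ).submatrix (Fin.castAdd q) (Fin.natAdd r) = 0 := by
  ext i j
  have : Fin.castAdd q i ≠ Fin.natAdd r j := by
    intro h; have := congrArg Fin.val h; simp at this; omega
  simp [this]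

theorem diagonal_submatrix_natAdd_castAdd (σ : Fin (r + q) → ℝ) :
    (Matrix.diagonal σ).submatrix (Fin.natAdd r) (Fin.castAdd q) = 0 := by
  ext i j
  have : Fin.natAdd r i ≠ Fin.castAdd q j := by
    intro h; have := congrArg Fin.val h; simp at this; omega
  simp [this]

end Blocks

section ErrorFormula

variable {r q s o : ℕ}

/-- The leading block of the observability Lyapunov equation in balanced coordinates. -/
theorem IsBalancing.leading_obs_lyapunov {P Q L R U Z : Matrix (Fin (r + q)) (Fin (r + q)) ℝ}
    {σ : Fin (r + q) → ℝ} (h : IsBalancing P Q L R U Z σ)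
    {A : Matrix (Fin (r + q)) (Fin (r + q)) ℝ} {H : Matrix (Fin o) (Fin (r + q)) ℝ}
    (hQ : Aᵀ * Q + Q * A + Hᵀ * H = 0) :
    ((leadingCols (balBasis R U σ))ᵀ * A * leadingCols (balBasis L Z σ))ᵀ *
        Matrix.diagonal (fun i => σ (Fin.castAdd q i)) +
      Matrix.diagonal (fun i => σ (Fin.castAdd q i)) *
        ((leadingCols (balBasis R U σ))ᵀ * A * leadingCols (balBasis L Z σ)) +
      (H * leadingCols (balBasis L Z σ))ᵀ * (H * leadingCols (balBasis L Z σ)) = 0 := by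
  have hb := h.symm.lyapunov (A := Aᵀ) (K := Hᵀ * H) (by rwa [Matrix.transpose_transpose])
  generalize balBasis R U σ = V at *
  generalize balBasis L Z σ = W at *
  have hA : Wᵀ * Aᵀ * V = (Vᵀ * A * W)ᵀ := by
    rw [Matrix.transpose_mul, Matrix.transpose_mul, Matrix.transpose_transpose, Matrix.mul_assoc]
  have hH : Wᵀ * (Hᵀ * H) * W = (H * W)ᵀ * (H * W) := by
    rw [Matrix.transpose_mul]; simp only [Matrix.mul_assoc]
  rw [hA, hH, Matrix.transpose_transpose] at hb
  have hb' := congrArg (fun X => X.submatrix (Fin.castAdd q) (Fin.castAdd q)) hb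
  simp only [Matrix.submatrix_add, Pi.add_apply, submatrix_mul_fin_add (Vᵀ * A * W)ᵀ,
    submatrix_mul_fin_add (Matrix.diagonal σ), diagonal_submatrix_castAdd,
    diagonal_submatrix_castAdd_natAdd, diagonal_submatrix_natAdd_castAdd, Matrix.mul_zero,
    Matrix.zero_mul, add_zero, Matrix.submatrix_zero] at hb'
  exact hb'

/-- The error form at the two input matrices is the trace in the balanced truncation error
formula. The Gramians may be singular: the oblique projection `W Vᵀ` onto balanced coordinates only
changes unobservable components, and these are annihilated by `Sᵀ`. -/
theorem IsBalancing.errorForm_eq {P Q L R U Z : Matrix (Fin (r + q)) (Fin (r + q)) ℝ}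
    {σ : Fin (r + q) → ℝ} (h : IsBalancing P Q L R U Z σ)
    {A V W : Matrix (Fin (r + q)) (Fin (r + q)) ℝ} {Lpr : Matrix (Fin (r + q)) (Fin s) ℝ}
    {H : Matrix (Fin o) (Fin (r + q)) ℝ} {S : Matrix (Fin (r + q)) (Fin r) ℝ}
    (hV : V = balBasis R U σ) (hW : W = balBasis L Z σ)
    (hP : A * P + P * Aᵀ + Lpr * Lprᵀ = 0)
    (hQ : Aᵀ * Q + Q * A + Hᵀ * H = 0)
    (hS : Aᵀ * S + S * ((leadingCols V)ᵀ * A * leadingCols W) + Hᵀ * (H * leadingCols W) = 0)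
    (hker : ∀ {κ : Type} [Fintype κ] (x : Matrix (Fin (r + q)) κ ℝ), Rᵀ * x = 0 → Sᵀ * x = 0) :
    errorForm (R * Rᵀ) S (Matrix.diagonal fun i => σ (Fin.castAdd q i)) Lpr
        ((leadingCols V)ᵀ * Lpr) =
      ((((trailingCols V)ᵀ * Lpr) * ((trailingCols V)ᵀ * Lpr)ᵀ +
        (2 : ℝ) • (trailingRows (Wᵀ * S) * ((leadingCols V)ᵀ * A * trailingCols W))) *
        Matrix.diagonal fun i => σ (Fin.natAdd r i)).trace := by
  have hP' := hP
  rw [h.reach_factor] at hP'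
  have hproj := h.proj_mul_factor
  obtain ⟨hpB, hpA⟩ := annihilates_of_lyapunov hP' hproj
  have hb1 := h.lyapunov hP
  have hobs := h.balBasis_transpose_mul_obs_mul
  rw [h.obs_factor] at hobs
  have r3 := h.leading_obs_lyapunov hQ
  rw [← hV, ← hW] at hpA hpB hb1 r3
  rw [← hW] at hobs
  have hpW : Rᵀ * (1 - W * Vᵀ) * A * W = 0 := by
    have hWL : W = L * (Z * Matrix.diagonal fun i => (Real.sqrt (σ i))⁻¹) := by
      rw [hW, balBasis, Matrix.mul_assoc]
    generalize Rᵀ * (1 - W * Vᵀ) = M at hpA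
    rw [hWL, ← Matrix.mul_assoc, hpA, Matrix.zero_mul]
  set Ab := Vᵀ * A * W with hAb
  set Bb := Vᵀ * Lpr with hBb
  set Sb := Wᵀ * S with hSb
  -- the observable part of `Lpr` and of `A W` is captured by balanced coordinates
  have hRB : Rᵀ * Lpr = Rᵀ * W * Bb := by
    rw [Matrix.mul_sub, Matrix.sub_mul, Matrix.mul_one, sub_eq_zero] at hpB
    rw [hpB, hBb]; simp only [Matrix.mul_assoc]
  have hSB : Sᵀ * Lpr = Sbᵀ * Bb := by
    have := hker ((1 - W * Vᵀ) * Lpr) (by rw [← Matrix.mul_assoc]; exact hpB)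
    rw [Matrix.sub_mul, Matrix.mul_sub, Matrix.one_mul, sub_eq_zero] at this
    rw [this, hSb, hBb, Matrix.transpose_mul, Matrix.transpose_transpose]
    simp only [Matrix.mul_assoc]
  have hSA : Sᵀ * (A * W) = Sbᵀ * Ab := by
    have := hker ((1 - W * Vᵀ) * (A * W)) (by simpa only [Matrix.mul_assoc] using hpW)
    rw [Matrix.sub_mul, Matrix.mul_sub, Matrix.one_mul, sub_eq_zero] at this
    rw [this, hSb, hAb, Matrix.transpose_mul, Matrix.transpose_transpose]
    simp only [Matrix.mul_assoc]
  have hQterm : Lprᵀ * (R * Rᵀ) * Lpr = Bbᵀ * Matrix.diagonal σ * Bb := by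
    have : Lprᵀ * (R * Rᵀ) * Lpr = (Rᵀ * Lpr)ᵀ * (Rᵀ * Lpr) := by
      simp only [Matrix.transpose_mul, Matrix.transpose_transpose, Matrix.mul_assoc]
    rw [this, hRB, ← hobs]
    simp only [Matrix.transpose_mul, Matrix.transpose_transpose, Matrix.mul_assoc]
  have hsylv : Abᵀ * Sb + Sb * Ab.submatrix (Fin.castAdd q) (Fin.castAdd q) +
      (H * W)ᵀ * (H * leadingCols W) = 0 := by
    have h1 := congrArg Matrix.transpose hSA
    rw [Matrix.transpose_mul, Matrix.transpose_mul, Matrix.transpose_mul,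
      Matrix.transpose_transpose, Matrix.transpose_transpose] at h1
    have h2 := congrArg (fun X => Wᵀ * X) hS
    simp only [Matrix.mul_add, Matrix.mul_zero] at h2
    have h3 : (leadingCols V)ᵀ * A * leadingCols W =
        Ab.submatrix (Fin.castAdd q) (Fin.castAdd q) := rfl
    rw [← h1, ← h2, h3, hSb, Matrix.transpose_mul H]
    simp only [Matrix.mul_assoc]
  have hBB : Vᵀ * (Lpr * Lprᵀ) * V = Bb * Bbᵀ := by
    rw [hBb, Matrix.transpose_mul, Matrix.transpose_transpose]; simp only [Matrix.mul_assoc]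
  rw [hBB] at hb1
  have r1 := congrArg (fun X => X.submatrix (Fin.castAdd q) (Fin.castAdd q)) hb1
  have r2 := congrArg (fun X => X.submatrix (Fin.castAdd q) (Fin.natAdd r)) hb1
  have r4 := congrArg (fun X => X.submatrix (Fin.castAdd q) id) hsylv
  simp only [Matrix.submatrix_add, Pi.add_apply, submatrix_mul_fin_add Ab, Matrix.submatrix_zero,
    submatrix_mul_fin_add Abᵀ, submatrix_mul_fin_add (Matrix.diagonal σ),
    diagonal_submatrix_castAdd, diagonal_submatrix_natAdd, diagonal_submatrix_castAdd_natAdd,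
    diagonal_submatrix_natAdd_castAdd, Matrix.mul_zero, Matrix.zero_mul, add_zero, zero_add]
    at r1 r2 r4
  have key := balanced_trace_identity (T₁ := Matrix.diagonal fun i => σ (Fin.castAdd q i))
    (T₂ := Matrix.diagonal fun i => σ (Fin.natAdd r i))
    (A₁ := Ab.submatrix (Fin.castAdd q) (Fin.castAdd q))
    (A₂ := Ab.submatrix (Fin.castAdd q) (Fin.natAdd r))
    (A₃ := Ab.submatrix (Fin.natAdd r) (Fin.castAdd q))
    (B₁ := Bb.submatrix (Fin.castAdd q) id) (B₂ := Bb.submatrix (Fin.natAdd r) id)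
    (S₁ := Sb.submatrix (Fin.castAdd q) id) (S₂ := Sb.submatrix (Fin.natAdd r) id)
    (K₁ := (H * leadingCols W)ᵀ * (H * leadingCols W)) r1 r2 r3 r4
  refine Eq.trans ?_ key
  have q1 : (Bbᵀ * Matrix.diagonal σ * Bb) =
      (Bb.submatrix (Fin.castAdd q) id)ᵀ * (Matrix.diagonal fun i => σ (Fin.castAdd q i)) *
        Bb.submatrix (Fin.castAdd q) id +
      (Bb.submatrix (Fin.natAdd r) id)ᵀ * (Matrix.diagonal fun i => σ (Fin.natAdd r i)) *
        Bb.submatrix (Fin.natAdd r) id := by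
    have := submatrix_mul_fin_add (Bbᵀ * Matrix.diagonal σ) Bb id id
    simp only [submatrix_mul_fin_add Bbᵀ, diagonal_submatrix_castAdd, diagonal_submatrix_natAdd,
      diagonal_submatrix_castAdd_natAdd, diagonal_submatrix_natAdd_castAdd, Matrix.mul_zero,
      add_zero, zero_add] at this
    exact this
  have q2 : Lprᵀ * S = (Bb.submatrix (Fin.castAdd q) id)ᵀ * Sb.submatrix (Fin.castAdd q) id +
      (Bb.submatrix (Fin.natAdd r) id)ᵀ * Sb.submatrix (Fin.natAdd r) id := by
    have h1 := congrArg Matrix.transpose hSB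
    rw [Matrix.transpose_mul, Matrix.transpose_mul, Matrix.transpose_transpose,
      Matrix.transpose_transpose] at h1
    rw [h1]
    exact submatrix_mul_fin_add Bbᵀ Sb id id
  have q3 : (leadingCols V)ᵀ * Lpr = Bb.submatrix (Fin.castAdd q) id := rfl
  rw [errorForm, hQterm, q1, q2, q3, Matrix.add_mul, Matrix.trace_add, Matrix.trace_add]

end ErrorFormula

/-! ### Sampling the output error -/

section Sampling

variable {n : ℕ}

theorem prevTime_lt {t : Fin n → ℝ} (ht : StrictMono t) (ht0 : ∀ k, 0 < t k) (k : Fin n) :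
    prevTime t k < t k := by
  unfold prevTime
  split_ifs with h
  · exact ht0 k
  · exact ht (by rw [Fin.lt_def]; simp only; omega)

/-- A continuous function that vanishes in mean square before each sampling time vanishes at the
sampling times, so finite sampling constants exist. -/
theorem exists_isSamplingBound {ο ς : Type*} [Fintype ο] [Fintype ς] {e : ℝ → Matrix ο ς ℝ}
    {t : Fin n → ℝ} (ht : StrictMono t) (ht0 : ∀ k, 0 < t k)
    (he : Continuous fun τ => frobNorm (e τ) ^ 2) : ∃ c, IsSamplingBound e t c := by
  refine ⟨fun k => frobNorm (e (t k)) ^ 2 / ∫ τ in (prevTime t k)..(t k), frobNorm (e τ) ^ 2,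
    fun k => ?_⟩
  have hlt := prevTime_lt ht ht0 k
  have h0 : 0 ≤ ∫ τ in (prevTime t k)..(t k), frobNorm (e τ) ^ 2 :=
    intervalIntegral.integral_nonneg hlt.le fun _ _ => sq_nonneg _
  refine ⟨div_nonneg (sq_nonneg _) h0, ?_⟩
  rcases h0.eq_or_lt with h | h
  · -- a positive value at `t k` would make the integral positive
    by_contra hne
    have hpos : 0 < frobNorm (e (t k)) ^ 2 := by
      refine lt_of_le_of_ne (sq_nonneg _) fun h1 => hne ?_
      rw [← h1, ← h]; simp
    have := intervalIntegral.integral_pos hlt he.continuousOn (fun _ _ => sq_nonneg _)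
      ⟨t k, Set.right_mem_Icc.2 hlt.le, hpos⟩
    linarith
  · rw [div_mul_cancel₀ _ h.ne']

theorem sum_integral_prevTime_le {g : ℝ → ℝ} (hg : Continuous g) {E : ℝ}
    (hE : ∀ τ, ∫ x in (0 : ℝ)..τ, g x ≤ E) (t : Fin n → ℝ) :
    ∑ k, ∫ x in (prevTime t k)..(t k), g x ≤ E := by
  set u : ℕ → ℝ := fun k => if h : k - 1 < n ∧ k ≠ 0 then t ⟨k - 1, h.1⟩ else 0 with hu
  have h1 : ∀ k : Fin n, prevTime t k = u k := by
    intro k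
    have := k.2
    unfold prevTime
    by_cases hk : (k : ℕ) = 0
    · simp [hu, hk]
    · have : (k : ℕ) - 1 < n := by omega
      simp [hu, hk, this]
  have h2 : ∀ k : Fin n, t k = u (k + 1) := fun k => by simp [hu]
  have h3 : ∑ k, ∫ x in (prevTime t k)..(t k), g x =
      ∑ k ∈ Finset.range n, ∫ x in (u k)..(u (k + 1)), g x := by
    rw [Finset.sum_range]
    exact Finset.sum_congr rfl fun k _ => by rw [h1, h2]
  rw [h3, intervalIntegral.sum_integral_adjacent_intervals fun k _ => hg.intervalIntegrable _ _]
  have : u 0 = 0 := by simp [hu]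
  rw [this]
  exact hE _

end Sampling

/-! ### Whitened observations -/

section Observation

variable {n : ℕ} {δ ο ς : Type*} [Fintype δ] [DecidableEq δ] [Fintype ο] [DecidableEq ο]
  [Fintype ς]

open scoped MatrixOrder in
theorem psdSqrt_obsCov {Ge : Matrix ο ο ℝ} (hGe : Ge.PosSemidef) :
    psdSqrt (obsCov n Ge) = obsCov n (psdSqrt Ge) := by
  refine CFC.sqrt_unique ?_ ?_
  · rw [obsCov, obsCov, ← Matrix.mul_kronecker_mul, (psdSqrt_spec hGe).2, Matrix.one_mul]
  · exact (Matrix.PosSemidef.one.kronecker (psdSqrt_spec hGe).1).nonneg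

omit [DecidableEq ο] in
theorem obsCov_posDef {Ge : Matrix ο ο ℝ} (hGe : Ge.PosDef) : (obsCov n Ge).PosDef :=
  Matrix.PosDef.one.kronecker hGe

omit [DecidableEq ο] [Fintype ς] in
theorem obsCov_mul_apply (D : Matrix ο ο ℝ) (X : Matrix (Fin n × ο) ς ℝ) (k : Fin n) (i : ο)
    (j : ς) : (obsCov n D * X) (k, i) j = ∑ l, D i l * X (k, l) j := by
  simp [obsCov, Matrix.mul_apply, Fintype.sum_prod_type, Matrix.one_apply, Finset.sum_ite_eq]

omit [Fintype ς] in
/-- The whitened observation map is the sampled impulse response. -/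
theorem hessSqrt_observationMap_apply {Ge : Matrix ο ο ℝ} (hGe : Ge.PosDef) (A : Matrix δ δ ℝ)
    (C : Matrix ο δ ℝ) (t : Fin n → ℝ) (B : Matrix δ ς ℝ) (k : Fin n) (i : ο) (j : ς) :
    hessSqrt (obsCov n Ge) (observationMap A C t) B (k, i) j =
      impulseResponse Ge A B C (t k) i j := by
  have hinv : (obsCov n (psdSqrt Ge))⁻¹ = obsCov n (psdSqrt Ge)⁻¹ := by
    rw [obsCov, Matrix.inv_kronecker, inv_one]; rfl
  rw [hessSqrt, psdSqrt_obsCov hGe.posSemidef, hinv, Matrix.mul_assoc, obsCov_mul_apply,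
    impulseResponse, Matrix.mul_assoc, Matrix.mul_assoc, Matrix.mul_apply]
  refine Finset.sum_congr rfl fun l _ => ?_
  rw [← Matrix.mul_assoc]
  rfl

omit [DecidableEq ο] in
theorem frobNorm_sq_prod (M : Matrix (Fin n × ο) ς ℝ) :
    frobNorm M ^ 2 = ∑ k, frobNorm (Matrix.of fun i j => M (k, i) j) ^ 2 := by
  simp only [frobNorm_sq, Fintype.sum_prod_type, Matrix.of_apply]

end Observation

section Lipschitz

variable {ω δ ς : Type*} [Fintype ω] [DecidableEq ω] [Fintype δ] [DecidableEq δ]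
  [Fintype ς] [DecidableEq ς]

omit [DecidableEq δ] in
theorem lipCov_nonneg (Gobs : Matrix ω ω ℝ) (L : Matrix δ ς ℝ) (G Ghat : Matrix ω δ ℝ) :
    0 ≤ lipCov Gobs L G Ghat := by
  have h1 := specNorm_nonneg (hessSqrt Gobs G L)
  have h2 := specNorm_nonneg (hessSqrt Gobs Ghat L)
  exact mul_nonneg (sq_nonneg _) (add_nonneg (add_nonneg (specNorm_nonneg _)
    (mul_nonneg (mul_nonneg h2 h1) (add_nonneg h1 h2))) (specNorm_nonneg _))

omit [DecidableEq δ] in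
theorem lipMean_nonneg (mupr : δ → ℝ) (Gpr : Matrix δ δ ℝ) (Gobs : Matrix ω ω ℝ)
    (L : Matrix δ ς ℝ) (G Ghat : Matrix ω δ ℝ) (m : ω → ℝ) :
    0 ≤ lipMean mupr Gpr Gobs L G Ghat m :=
  add_nonneg (add_nonneg (mul_nonneg (lipCov_nonneg _ _ _ _) (l2Norm_nonneg _))
    (mul_nonneg (specNorm_nonneg _) (l2Norm_nonneg _)))
    (mul_nonneg (specNorm_nonneg _) (l2Norm_nonneg _))

end Lipschitz

end PDBT

end

open PDBT in
theorem theorem4p1 {r q s o n : ℕ}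
    -- the smoothing problem: state dimension `r + q`, data `m` at the times `t`
    (A : Matrix (Fin (r + q)) (Fin (r + q)) ℝ) (C : Matrix (Fin o) (Fin (r + q)) ℝ)
    (Ge : Matrix (Fin o) (Fin o) ℝ) (Gpr : Matrix (Fin (r + q)) (Fin (r + q)) ℝ)
    (Lpr : Matrix (Fin (r + q)) (Fin s) ℝ) (t : Fin n → ℝ) (m : Fin n × Fin o → ℝ)
    (hA : IsStable A) (hGe : Ge.PosDef) (hGpr : Gpr.PosSemidef) (hLpr : Gpr = Lpr * Lprᵀ)
    (ht : StrictMono t) (ht_pos : ∀ k, 0 < t k)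
    -- balancing of the prior-driven system
    (L R U Z : Matrix (Fin (r + q)) (Fin (r + q)) ℝ) (σ : Fin (r + q) → ℝ)
    (hbal : IsBalancing (reachGramian A Gpr) (obsGramian A C Ge) L R U Z σ)
    (hσ : ∀ i : Fin r, 0 < σ (Fin.castAdd q i))
    (V W : Matrix (Fin (r + q)) (Fin (r + q)) ℝ)
    (hV : V = balBasis R U σ) (hW : W = balBasis L Z σ)
    -- the reduced system
    (Ar : Matrix (Fin r) (Fin r) ℝ) (hAr : Ar = (leadingCols V)ᵀ * A * leadingCols W)
    (Lprr : Matrix (Fin r) (Fin s) ℝ) (hLprr : Lprr = (leadingCols V)ᵀ * Lpr)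
    (Cr : Matrix (Fin o) (Fin r) ℝ) (hCr : Cr = C * leadingCols W)
    -- the quantities in the bound
    (S : Matrix (Fin (r + q)) (Fin r) ℝ) (hS : Aᵀ * S + S * Ar + Cᵀ * Ge⁻¹ * Cr = 0)
    (Sbar : Matrix (Fin q) (Fin r) ℝ) (hSbar : Sbar = trailingRows (Wᵀ * S))
    (Lbar : Matrix (Fin q) (Fin s) ℝ) (hLbar : Lbar = (trailingCols V)ᵀ * Lpr)
    (Abar : Matrix (Fin r) (Fin q) ℝ) (hAbar : Abar = (leadingCols V)ᵀ * A * trailingCols W)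
    (Sigbar : Matrix (Fin q) (Fin q) ℝ)
    (hSigbar : Sigbar = Matrix.diagonal fun i => σ (Fin.natAdd r i))
    -- exact and reduced forward models, noise covariance, posteriors
    (G Ghat : Matrix (Fin n × Fin o) (Fin (r + q)) ℝ) (hG : G = observationMap A C t)
    (hGhat : Ghat = observationMap Ar Cr t * (leadingCols V)ᵀ)
    (Gobs : Matrix (Fin n × Fin o) (Fin n × Fin o) ℝ) (hGobs : Gobs = obsCov n Ge)
    (Gpos Gposhat : Matrix (Fin (r + q)) (Fin (r + q)) ℝ)
    (hGpos : Gpos = posteriorCov Gpr Gobs G) (hGposhat : Gposhat = posteriorCov Gpr Gobs Ghat)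
    (mupos muposhat : Fin (r + q) → ℝ)
    (hmupos : mupos = posteriorMean 0 Gpr Gobs G m)
    (hmuposhat : muposhat = posteriorMean 0 Gpr Gobs Ghat m)
    -- the impulse response error
    (e : ℝ → Matrix (Fin o) (Fin s) ℝ)
    (he : ∀ τ, e τ = impulseResponse Ge A Lpr C τ - impulseResponse Ge Ar Lprr Cr τ) :
    (∃ c : Fin n → ℝ, IsSamplingBound e t c) ∧
    ∀ (c : Fin n → ℝ) (κ : ℝ), IsSamplingBound e t c → IsGreatest (Set.range c) κ →
      frobNorm (Gpos - Gposhat) ≤ lipCov Gobs Lpr G Ghat *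
        Real.sqrt (κ * ((Lbar * Lbarᵀ + (2 : ℝ) • (Sbar * Abar)) * Sigbar).trace) ∧
      l2Norm (mupos - muposhat) = frobNorm (Matrix.replicateCol Unit (mupos - muposhat)) ∧
      l2Norm (mupos - muposhat) ≤ lipMean 0 Gpr Gobs Lpr G Ghat m *
        Real.sqrt (κ * ((Lbar * Lbarᵀ + (2 : ℝ) • (Sbar * Abar)) * Sigbar).trace) := by
  subst hGpos hGposhat hmupos hmuposhat hLpr
  -- whitening turns `Cᵀ Ge⁻¹ C` into `Hᵀ H` for the output matrix `H = D C`
  set D := (psdSqrt Ge)⁻¹ with hD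
  have hDt : Dᵀ = D := inv_psdSqrt_transpose hGe.posSemidef
  have hDD : D * D = Ge⁻¹ := inv_psdSqrt_mul_self hGe.posSemidef
  have hHH : ∀ {κ : Type} (X : Matrix (Fin o) κ ℝ), (D * C)ᵀ * (D * X) = Cᵀ * Ge⁻¹ * X := by
    intro κ X
    rw [Matrix.transpose_mul, hDt, ← hDD]; simp only [Matrix.mul_assoc]
  have hKW : D * Cr = D * C * leadingCols W := by rw [hCr, Matrix.mul_assoc]
  have heq : ∀ τ, e τ = D * C * (NormedSpace.exp (τ • A) * Lpr) -
      D * Cr * (NormedSpace.exp (τ • Ar) * Lprr) := by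
    intro τ; rw [he]; simp only [impulseResponse, ← hD, Matrix.mul_assoc]
  have hcont : Continuous fun τ => frobNorm (e τ) ^ 2 := by
    simp only [heq]; exact continuous_frobNorm_sq_output Lpr Lprr
  have hP := reachGramian_lyapunov hA (Lpr * Lprᵀ)
  have hQ : Aᵀ * obsGramian A C Ge + obsGramian A C Ge * A + (D * C)ᵀ * (D * C) = 0 := by
    rw [hHH]; exact obsGramian_lyapunov hA C Ge
  have hQ' := hQ
  rw [hbal.obs_factor] at hQ'
  have hS' : Aᵀ * S + S * Ar + (D * C)ᵀ * (D * Cr) = 0 := by rw [hHH]; exact hS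
  have hT := hbal.leading_obs_lyapunov hQ
  rw [← hV, ← hW, ← hAr, ← hKW] at hT
  have htrace := hbal.errorForm_eq hV hW hP hQ (by rw [← hAr, ← hKW]; exact hS')
    fun x hx => sylvester_transpose_mul_eq_zero hA hσ hQ' hS' hT hx
  rw [← hLprr, ← hLbar, ← hAbar, ← hSbar, ← hSigbar] at htrace
  have henergy : ∀ τ, ∫ x in (0 : ℝ)..τ, frobNorm (e x) ^ 2 ≤
      ((Lbar * Lbarᵀ + (2 : ℝ) • (Sbar * Abar)) * Sigbar).trace := by
    intro τ
    rw [← htrace]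
    simp only [heq]
    exact integral_output_error_le hA hσ hQ' hS' hT Lpr Lprr τ
  refine ⟨exists_isSamplingBound ht ht_pos hcont, fun c κ hc hκ => ?_⟩
  set E := ((Lbar * Lbarᵀ + (2 : ℝ) • (Sbar * Abar)) * Sigbar).trace
  have hκ0 : 0 ≤ κ := by
    obtain ⟨k, rfl⟩ := hκ.1
    exact (hc k).1
  have hGobsPD : Gobs.PosDef := by rw [hGobs]; exact obsCov_posDef hGe
  have hblock : ∀ k, (Matrix.of fun i j =>
      (hessSqrt Gobs G Lpr - hessSqrt Gobs Ghat Lpr) (k, i) j) = e (t k) := by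
    intro k
    have h1 : hessSqrt Gobs Ghat Lpr = hessSqrt Gobs (observationMap Ar Cr t) Lprr := by
      rw [hGhat, hLprr]; simp only [hessSqrt, Matrix.mul_assoc]
    ext i j
    rw [Matrix.of_apply, Matrix.sub_apply, h1, hG, hGobs, hessSqrt_observationMap_apply hGe,
      hessSqrt_observationMap_apply hGe, he, Matrix.sub_apply]
  have hsq : frobNorm (hessSqrt Gobs G Lpr - hessSqrt Gobs Ghat Lpr) ^ 2 ≤ κ * E := by
    rw [frobNorm_sq_prod]
    simp only [hblock]
    calc ∑ k, frobNorm (e (t k)) ^ 2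
        ≤ ∑ k, κ * ∫ τ in (prevTime t k)..(t k), frobNorm (e τ) ^ 2 :=
          Finset.sum_le_sum fun k _ => (hc k).2.trans (mul_le_mul_of_nonneg_right
            (hκ.2 ⟨k, rfl⟩) (intervalIntegral.integral_nonneg (prevTime_lt ht ht_pos k).le
              fun _ _ => sq_nonneg _))
      _ = κ * ∑ k, ∫ τ in (prevTime t k)..(t k), frobNorm (e τ) ^ 2 := by rw [Finset.mul_sum]
      _ ≤ κ * E := mul_le_mul_of_nonneg_left (sum_integral_prevTime_le hcont henergy t) hκ0
  have hsqrt := Real.le_sqrt_of_sq_le hsq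
  exact ⟨(frobNorm_posteriorCov_sub_le hGobsPD Lpr G Ghat).trans
      (mul_le_mul_of_nonneg_left hsqrt (lipCov_nonneg _ _ _ _)),
    (frobNorm_replicateCol _).symm,
    (l2Norm_posteriorMean_sub_le hGobsPD Lpr G Ghat m).trans
      (mul_le_mul_of_nonneg_left hsqrt (lipMean_nonneg _ _ _ _ _ _ _))⟩
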